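/- Let $\alpha\in(0,1)$ and let $W:\mathbb R\to\mathbb R$ be strictly increasing with $\lim_{x\to\pm\infty}W(x)=\pm\infty$ (for example, almost any realization of a double-sided $\alpha$-stable subordinator). For an integer $n\ge 1$ put $\Delta W^n_x=W(\tfrac{x+1}{n})-W(\tfrac{x}{n})$ and $\xi^n_x=n^{1/\alpha}\Delta W^n_x$, $x\in\mathbb Z$, and let $p_n(x,x+1)=p_n(x+1,x)=1/\xi^n_x$ and $p_n(x,y)=0$ if $|x-y|\ne1$. Let $g(0)=0$ and $g(k)=1$ for $k\ge1$. The zero-range process with jump rate $p_n$ and interaction rate $g$ is the càdlàg process $(\eta_t)_{t\ge0}$ on $\mathbb N_0^{\mathbb Z}$ that solves the martingale problem, on bounded functions $f$ of finitely many coordinates, for $$Lf(\eta)=\sum_{x,y\in\mathbb Z}p_n(x,y)\,g(\eta(x))\,\bigl[f(\eta^{x,y})-f(\eta)\bigr],$$ where $\eta^{x,y}$ is obtained from $\eta$ by moving one particle from $x$ to $y$. Let $\rho>0$, and let $\nu_\rho$ be the product measure on $\mathbb N_0^{\mathbb Z}$ with one-site marginals $k\mapsto Z(\varphi)^{-1}\varphi^k/(g(1)\cdots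 g(k))$, where $Z(\varphi)$ is the normalizing constant and $\varphi=\varphi(\rho)\in(0,1)$ is the parameter for which the mean number of particles per site is $\rho$. Start the process from $\nu_\rho$, set $\eta^n_s=\eta_{s n^{1+1/\alpha}}$, and denote by $\mathbb E^n$ the corresponding expectation. Then, for every $t\ge0$ and every function $H:\mathbb R\to\mathbb R$, $$\mathbb E^n\Bigl[\Bigl(\int_0^t\frac1{n^{1/2}}\sum_{x\in\mathbb Z}n\bigl(g(\eta^n_s(x))-g(\eta^n_s(x+1))\bigr)H(x/n)\,ds\Bigr)^2\Bigr]\le 5t\,\varphi(\rho)^{-1}\sum_{x\in\mathbb Z}H(x/n)^2\,\Delta W^n_x .$$ Here, whenever the right-hand side is finite (otherwise there is nothing to claim), the time integral is the limit in $L^2$ of the time integrals of the partial sums over finite sets of sites; this limit exists, and it equals almost surely the pathwise integral of the series whenever $\sum_{x\in\mathbb Z}|H(x/n)|<\infty$. -/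

import Mathlib

open MeasureTheory ProbabilityTheory Filter Topology
open scoped NNReal ENNReal

noncomputable section

namespace ZeroRange

/-- Configurations of particles on `ℤ`: `η x` is the number of particles at site `x`. -/
abbrev Config : Type := ℤ → ℕ

/-- The configuration `η^{x,y}`: one particle has been moved from site `x` to site `y`.
It is only ever used when there is a particle at `x` and `x ≠ y`. -/
def move (x y : ℤ) (η : Config) : Config :=
  fun z => if z = x then η x - 1 else if z = y then η y + 1 else η z

/-- The generator of the zero-range process with jump rate `p` and interaction rate `g`,
`L f (η) = ∑_{x,y} p(x,y) g(η(x)) [f(η^{x,y}) - f(η)]`. For a local function `f` and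
nearest-neighbour `p`, only finitely many terms are nonzero. -/
def generator (p : ℤ → ℤ → ℝ) (g : ℕ → ℝ) (f : Config → ℝ) (η : Config) : ℝ :=
  ∑' x : ℤ, ∑' y : ℤ, p x y * g (η x) * (f (move x y η) - f η)

/-- `η` is (with respect to the filtration `𝓕`, under `P`) a zero-range process with jump rate
`p`, interaction rate `g` and initial distribution `μ₀`: a càdlàg process that solves the
martingale problem for the generator on bounded local functions. -/
structure IsZeroRangeProcess {Ω : Type*} {mΩ : MeasurableSpace Ω}
    (p : ℤ → ℤ → ℝ) (g : ℕ → ℝ) (μ₀ : Measure Config)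
    (𝓕 : Filtration ℝ≥0 mΩ) (P : Measure Ω) (η : ℝ≥0 → Ω → Config) : Prop where
  adapted : ∀ t, Measurable[𝓕 t] (η t)
  right_continuous : ∀ ω t, ContinuousWithinAt (fun s => η s ω) (Set.Ici t) t
  left_limits : ∀ ω t, ∃ ζ : Config, Tendsto (fun s => η s ω) (𝓝[<] t) (𝓝 ζ)
  initial : P.map (η 0) = μ₀
  martingale : ∀ (f : Config → ℝ) (A : Finset ℤ), DependsOn f (A : Set ℤ) →
    (∃ C : ℝ, ∀ ζ, |f ζ| ≤ C) →
    Martingale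
      (fun (t : ℝ≥0) ω => f (η t ω) - ∫ s in (0 : ℝ)..t, generator p g f (η s.toNNReal ω)) 𝓕 P

/-! ### Invariant measures -/

/-- `g(n)! = g(1) ⋯ g(n)`, with `g(0)! = 1`. -/
def rateFactorial (g : ℕ → ℝ) (n : ℕ) : ℝ := ∏ i ∈ Finset.range n, g (i + 1)

/-- `Z(φ) = ∑_n φ^n / g(n)!`. -/
def partitionFunction (g : ℕ → ℝ) (φ : ℝ) : ℝ := ∑' n : ℕ, φ ^ n / rateFactorial g n

/-- `φ_c = liminf_n (g(n)!)^{1/n}`. -/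
def criticalFugacity (g : ℕ → ℝ) : ℝ≥0∞ :=
  liminf (fun n : ℕ => ENNReal.ofReal (rateFactorial g n ^ (1 / (n : ℝ)))) atTop

/-- The one-site marginal, which gives mass `Z(φ)⁻¹ φ^k / g(k)!` to `k`. -/
def marginal (g : ℕ → ℝ) (φ : ℝ) : Measure ℕ :=
  Measure.sum fun k : ℕ =>
    ENNReal.ofReal ((partitionFunction g φ)⁻¹ * (φ ^ k / rateFactorial g k)) • Measure.dirac k

/-- The product measure of fugacity `φ`. -/
def productLaw (g : ℕ → ℝ) (φ : ℝ) : Measure Config :=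
  Measure.infinitePi fun _ : ℤ => marginal g φ

/-- The density of particles as a function of the fugacity. -/
def density (g : ℕ → ℝ) (φ : ℝ) : ℝ := ∫ η : Config, (η 0 : ℝ) ∂(productLaw g φ)

/-- The fugacity as a function of the density: the inverse of `density g` on `[0, φ_c)`. -/
def fugacity (g : ℕ → ℝ) (ρ : ℝ) : ℝ :=
  Function.invFunOn (density g) {φ : ℝ | 0 ≤ φ ∧ ENNReal.ofReal φ < criticalFugacity g} ρ

/-- The invariant product measure of density `ρ`. -/
def equilibrium (g : ℕ → ℝ) (ρ : ℝ) : Measure Config := productLaw g (fugacity g ρ)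

/-! ### The environment and the interaction rate -/

/-- The interaction rate `g(0) = 0`, `g(k) = 1` for `k ≥ 1`. -/
def unitRate (k : ℕ) : ℝ := if k = 0 then 0 else 1

/-- The increment `W((x+1)/n) - W(x/n)`. -/
def increment (W : ℝ → ℝ) (n : ℕ) (x : ℤ) : ℝ := W (((x : ℝ) + 1) / n) - W ((x : ℝ) / n)

/-- The environment `ξ_x^n = n^{1/α} {W((x+1)/n) - W(x/n)}`. -/
def environment (α : ℝ) (W : ℝ → ℝ) (n : ℕ) (x : ℤ) : ℝ :=
  (n : ℝ) ^ (1 / α) * increment W n x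

/-- The jump rate `p_n(x,x+1) = p_n(x+1,x) = 1/ξ_x^n`, and `p_n(x,y) = 0` if `|x-y| ≠ 1`. -/
def jumpRate (α : ℝ) (W : ℝ → ℝ) (n : ℕ) (x y : ℤ) : ℝ :=
  if y = x + 1 then (environment α W n x)⁻¹
  else if x = y + 1 then (environment α W n y)⁻¹
  else 0

/-- The process `η_s^n = η_{s n^{1 + 1/α}}`, run on the subdiffusive time scale. -/
def rescaled {Ω : Type*} (α : ℝ) (n : ℕ) (η : ℝ≥0 → Ω → Config) (s : ℝ) (ω : Ω) : Config :=
  η (s * (n : ℝ) ^ (1 + 1 / α)).toNNReal ω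

/-- The current term `n (g(η(x)) - g(η(x+1))) H(x/n)`. -/
def currentTerm (g : ℕ → ℝ) (n : ℕ) (H : ℝ → ℝ) (x : ℤ) (η : Config) : ℝ :=
  n * (g (η x) - g (η (x + 1))) * H ((x : ℝ) / n)

end ZeroRange

end

/-!
Paired in equilibrium with an observable `f`, the current `g(η(x)) - g(η(x+1))` gives `-φ` times the
mean of the gradient of `f` across the bond, so it is controlled by the Dirichlet form: after
completing the square, `2 ⟨V, f⟩ + ⟨f, L f⟩ ≤ φ ∑ₓ a(x)² / c(x)` for
`V = ∑ₓ a(x) (g(η(x)) - g(η(x+1)))` and conductances `c` (`current_variational`). For a symmetric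
semigroup this bounds `∫₀ˢ ⟨V, e^{τL} V⟩ dτ` (`integral_autocorrelation_le`), hence the second
moment of `∫₀ᵀ V(η_s) ds` by `2 T φ ∑ₓ a(x)² / c(x)`. Since `1 / c(x)` is the environment
`n^{1/α} ΔWⁿ_x` and `φ < 1`, the theorem follows after the time change by `n^{1 + 1/α}`, with `2 φ`
in place of `5 / φ`.

The process is only known to solve a martingale problem whose rates may be unbounded, so neither its
stationarity nor its Markov property is given. Both are obtained, for local observables, by duality
with the system in a box `{-R, …, R}` in contact with reservoirs of fugacity `φ` at both ends. Its
generator `reservoirGen` is a bounded operator on bounded continuous observables, its semigroup is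
an exponential series, and the product measure is reversible for it
(`integral_mul_reservoirGen`). On observables of the box, the two generators differ only
by the effect of one extra particle at an end of the box
(`abs_reservoirGen_succ_sub_le`). An extra particle performs a walk that moves only when
its site is otherwise empty. Hence a superharmonic weight that dominates its effect at time `0` does
so at all times (`abs_discrepancy_reservoirSemigroup_le`), and a hitting probability of the random
walk is such a weight. Its flux through the ends of the box is the effective conductance between
the support of the observable and the ends, which tends to `0` because `W` diverges at both
infinities (`tendsto_leak`). Differentiating `s ↦ E[G (e^{(t-s) L_R} f)(η_s)]` then gives the
duality (`IsZeroRangeProcess.abs_expectation_sub_le`).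
-/

namespace ZeroRange

/-! ### Adding and removing particles, with reservoirs outside a finite volume -/

/-- One more particle at `x`, when `x` lies in the volume `Λ`; the reservoirs outside `Λ` absorb
the particle without a trace. -/
def addIn (Λ : Finset ℤ) (x : ℤ) (η : Config) : Config :=
  if x ∈ Λ then Function.update η x (η x + 1) else η

/-- One particle less at `x`, when `x` lies in the volume `Λ`; the reservoirs outside `Λ` are
inexhaustible. -/
def removeIn (Λ : Finset ℤ) (x : ℤ) (η : Config) : Config :=
  if x ∈ Λ then Function.update η x (η x - 1) else η

/-- The rate at which `x` emits particles: `unitRate` in the volume `Λ`, and the constant `φ`, which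
is the mean of `unitRate` in equilibrium, in the reservoirs outside. -/
noncomputable def rateIn (φ : ℝ) (Λ : Finset ℤ) (x : ℤ) (η : Config) : ℝ :=
  if x ∈ Λ then unitRate (η x) else φ

lemma unitRate_nonneg (k : ℕ) : 0 ≤ unitRate k := by unfold unitRate; split_ifs <;> simp

lemma unitRate_le_one (k : ℕ) : unitRate k ≤ 1 := by unfold unitRate; split_ifs <;> simp

lemma rateIn_nonneg {φ : ℝ} (h : 0 ≤ φ) (Λ : Finset ℤ) (x : ℤ) (η : Config) :
    0 ≤ rateIn φ Λ x η := by
  unfold rateIn; split_ifs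
  exacts [unitRate_nonneg _, h]

lemma rateIn_le_one {φ : ℝ} (h : φ ≤ 1) (Λ : Finset ℤ) (x : ℤ) (η : Config) :
    rateIn φ Λ x η ≤ 1 := by
  unfold rateIn; split_ifs
  exacts [unitRate_le_one _, h]

lemma addIn_of_notMem {Λ : Finset ℤ} {x : ℤ} (h : x ∉ Λ) (η : Config) : addIn Λ x η = η := by
  simp [addIn, h]

lemma addIn_comm (Λ : Finset ℤ) (x y : ℤ) (η : Config) :
    addIn Λ x (addIn Λ y η) = addIn Λ y (addIn Λ x η) := by
  by_cases hxy : x = y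
  · rw [hxy]
  unfold addIn
  split_ifs <;> try rfl
  simp [Function.update_of_ne hxy, Function.update_of_ne (Ne.symm hxy),
    Function.update_comm hxy]

lemma removeIn_addIn_self (Λ : Finset ℤ) (x : ℤ) (η : Config) :
    removeIn Λ x (addIn Λ x η) = η := by
  unfold removeIn addIn
  split_ifs <;> simp

lemma addIn_removeIn_self {Λ : Finset ℤ} {x : ℤ} {η : Config} (h : x ∈ Λ → η x ≠ 0) :
    addIn Λ x (removeIn Λ x η) = η := by
  unfold removeIn addIn
  split_ifs with hx
  · simp [Nat.sub_add_cancel (Nat.one_le_iff_ne_zero.2 (h hx))]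
  · rfl

lemma removeIn_addIn_of_ne (Λ : Finset ℤ) {x z : ℤ} (h : z ≠ x) (η : Config) :
    removeIn Λ z (addIn Λ x η) = addIn Λ x (removeIn Λ z η) := by
  unfold removeIn addIn
  split_ifs <;> try rfl
  simp [Function.update_of_ne h, Function.update_of_ne (Ne.symm h), Function.update_comm h]

lemma rateIn_addIn_of_ne (φ : ℝ) (Λ : Finset ℤ) {x z : ℤ} (h : z ≠ x) (η : Config) :
    rateIn φ Λ z (addIn Λ x η) = rateIn φ Λ z η := by
  unfold rateIn addIn
  split_ifs <;> simp [Function.update_of_ne h]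

lemma rateIn_addIn_self (φ : ℝ) {Λ : Finset ℤ} {x : ℤ} (h : x ∈ Λ) (η : Config) :
    rateIn φ Λ x (addIn Λ x η) = 1 := by
  simp [rateIn, addIn, h, unitRate]

lemma continuous_addIn (Λ : Finset ℤ) (x : ℤ) : Continuous (addIn Λ x) := by
  unfold addIn
  split_ifs
  · exact continuous_id.update x ((continuous_of_discreteTopology (f := fun k : ℕ => k + 1)).comp
      (continuous_apply x))
  · exact continuous_id

lemma continuous_removeIn (Λ : Finset ℤ) (x : ℤ) : Continuous (removeIn Λ x) := by
  unfold removeIn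
  split_ifs
  · exact continuous_id.update x ((continuous_of_discreteTopology (f := fun k : ℕ => k - 1)).comp
      (continuous_apply x))
  · exact continuous_id

lemma continuous_unitRate_apply (x : ℤ) : Continuous fun η : Config => unitRate (η x) :=
  (continuous_of_discreteTopology (f := unitRate)).comp (continuous_apply x)

lemma continuous_rateIn (φ : ℝ) (Λ : Finset ℤ) (x : ℤ) : Continuous (rateIn φ Λ x) := by
  unfold rateIn
  split_ifs
  exacts [continuous_unitRate_apply x, continuous_const]

/-- Two configurations that agree on `Λ` still do so after the same jump, even if it is performed in
a larger volume for one of them. -/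
lemma addIn_removeIn_congr {Λ : Finset ℤ} {η ζ : Config} (h : ∀ i ∈ (Λ : Set ℤ), η i = ζ i)
    (Λ' : Finset ℤ) (hΛ : Λ ⊆ Λ') (x y : ℤ) :
    ∀ i ∈ (Λ : Set ℤ), addIn Λ y (removeIn Λ x η) i = addIn Λ' y (removeIn Λ' x ζ) i := by
  intro i hi
  have hi' : i ∈ Λ' := hΛ hi
  have hi'' : i ∈ Λ := hi
  have := h i hi
  unfold addIn removeIn
  split_ifs with h1 h2 h3 h4 <;> by_cases e1 : i = x <;> by_cases e2 : i = y <;> subst_vars <;>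
    simp_all [Function.update_apply]

/-! ### The generator of a finite volume with reservoirs -/

/-- Bounded continuous observables; every bounded local function is one. -/
abbrev Obs : Type := BoundedContinuousFunction Config ℝ

/-- The rate `rateIn` as an observable. -/
noncomputable def rateObs (φ : ℝ) (Λ : Finset ℤ) (x : ℤ) : Obs :=
  BoundedContinuousFunction.ofNormedAddCommGroup (rateIn φ Λ x) (continuous_rateIn φ Λ x)
    (max 1 |φ|) fun η => by
      unfold rateIn
      split_ifs
      · rw [Real.norm_of_nonneg (unitRate_nonneg _)]
        exact (unitRate_le_one _).trans (le_max_left _ _)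
      · exact le_max_right _ _

/-- The effect on observables of an attempted jump from `x` to `y`, which succeeds with probability
`rateIn φ Λ x`. -/
noncomputable def jumpOp (φ : ℝ) (Λ : Finset ℤ) (x y : ℤ) : Obs →L[ℝ] Obs :=
  1 + (ContinuousLinearMap.mul ℝ Obs (rateObs φ Λ x)).comp
    (BoundedContinuousFunction.compContinuousCLM ℝ ℝ
      (⟨fun η => addIn Λ y (removeIn Λ x η),
        (continuous_addIn Λ y).comp (continuous_removeIn Λ x)⟩ : C(Config, Config)) - 1)

lemma jumpOp_apply (φ : ℝ) (Λ : Finset ℤ) (x y : ℤ) (f : Obs) (η : Config) :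
    jumpOp φ Λ x y f η
      = f η + rateIn φ Λ x η * (f (addIn Λ y (removeIn Λ x η)) - f η) := by
  simp only [jumpOp, add_apply, ContinuousLinearMap.comp_apply,
    sub_apply, one_apply_eq_self,
    BoundedContinuousFunction.compContinuousCLM_apply, ContinuousLinearMap.mul_apply',
    BoundedContinuousFunction.coe_add, BoundedContinuousFunction.coe_mul, Pi.add_apply,
    Pi.mul_apply, BoundedContinuousFunction.coe_sub, Pi.sub_apply,
    BoundedContinuousFunction.compContinuous_apply]
  rfl

/-- The volume `{-R, …, R}`. -/
noncomputable def box (R : ℕ) : Finset ℤ := Finset.Icc (-(R : ℤ)) R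

/-- The left end points of the bonds that meet `box R`. -/
noncomputable def bonds (R : ℕ) : Finset ℤ := Finset.Icc (-(R : ℤ) - 1) R

/-- The sum, over all bonds that meet `box R` and both directions, of the jump operators weighted by
the conductances `c`. -/
noncomputable def sumOp (c : ℤ → ℝ) (φ : ℝ) (R : ℕ) : Obs →L[ℝ] Obs :=
  ∑ x ∈ bonds R, c x • (jumpOp φ (box R) x (x + 1) + jumpOp φ (box R) (x + 1) x)

/-- The total rate of attempted jumps. -/
noncomputable def totalRate (c : ℤ → ℝ) (R : ℕ) : ℝ := ∑ x ∈ bonds R, 2 * c x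

/-- The generator of the zero-range process in `box R`, with conductances `c`, in contact with
reservoirs of fugacity `φ` at both ends. It is a bounded operator. -/
noncomputable def reservoirGen (c : ℤ → ℝ) (φ : ℝ) (R : ℕ) : Obs →L[ℝ] Obs :=
  sumOp c φ R - totalRate c R • 1

lemma sumOp_apply (c : ℤ → ℝ) (φ : ℝ) (R : ℕ) (f : Obs) (η : Config) :
    sumOp c φ R f η = ∑ x ∈ bonds R,
      c x * (jumpOp φ (box R) x (x + 1) f η + jumpOp φ (box R) (x + 1) x f η) := by
  simp [sumOp, BoundedContinuousFunction.sum_apply, mul_add]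

lemma reservoirGen_apply (c : ℤ → ℝ) (φ : ℝ) (R : ℕ) (f : Obs) (η : Config) :
    reservoirGen c φ R f η = ∑ x ∈ bonds R, c x *
      (rateIn φ (box R) x η * (f (addIn (box R) (x + 1) (removeIn (box R) x η)) - f η) +
       rateIn φ (box R) (x + 1) η *
        (f (addIn (box R) x (removeIn (box R) (x + 1) η)) - f η)) := by
  have : reservoirGen c φ R f η = sumOp c φ R f η - totalRate c R * f η := by
    simp [reservoirGen]
  rw [this, sumOp_apply, totalRate, Finset.sum_mul, ← Finset.sum_sub_distrib]
  refine Finset.sum_congr rfl fun x _ => ?_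
  rw [jumpOp_apply, jumpOp_apply]
  ring

/-- A jump operator keeps observables local. -/
lemma dependsOn_jumpOp {φ : ℝ} {Λ : Finset ℤ} {f : Obs} (hf : DependsOn f (Λ : Set ℤ)) (x y : ℤ) :
    DependsOn (jumpOp φ Λ x y f) (Λ : Set ℤ) := by
  intro η ζ h
  have h1 : rateIn φ Λ x η = rateIn φ Λ x ζ := by
    unfold rateIn
    split_ifs with hx
    · rw [h x hx]
    · rfl
  rw [jumpOp_apply, jumpOp_apply, h1, hf h, hf (addIn_removeIn_congr h Λ subset_rfl x y)]

lemma dependsOn_sumOp {c : ℤ → ℝ} {φ : ℝ} {R : ℕ} {f : Obs}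
    (hf : DependsOn f (box R : Set ℤ)) : DependsOn (sumOp c φ R f) (box R : Set ℤ) := by
  intro η ζ h
  rw [sumOp_apply, sumOp_apply]
  refine Finset.sum_congr rfl fun x _ => ?_
  rw [dependsOn_jumpOp hf _ _ h, dependsOn_jumpOp hf _ _ h]

lemma dependsOn_reservoirGen {c : ℤ → ℝ} {φ : ℝ} {R : ℕ} {f : Obs}
    (hf : DependsOn f (box R : Set ℤ)) : DependsOn (reservoirGen c φ R f) (box R : Set ℤ) := by
  intro η ζ h
  have := dependsOn_sumOp (c := c) (φ := φ) hf h
  simp [reservoirGen, this, hf h]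

/-! ### Semigroups of bounded generators -/

/-- The semigroup `s ↦ exp (s L)` of a bounded operator `L`. -/
noncomputable def expFlow {E : Type*} [NormedAddCommGroup E] [NormedSpace ℝ E]
    (L : E →L[ℝ] E) (s : ℝ) : E →L[ℝ] E := NormedSpace.exp (s • L)

/-- If the powers of `A` grow at most like `a ^ k` along `ℓ`, then the semigroup generated by
`A - a` is bounded along `ℓ`: it is the Poisson mixture `∑ₖ e^{-sa} (sa)^k / k! (A / a)^k`. -/
lemma abs_apply_exp_le {E : Type*} [NormedAddCommGroup E] [NormedSpace ℝ E] [CompleteSpace E]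
    (A : E →L[ℝ] E) {a C : ℝ} (ℓ : E →L[ℝ] ℝ) (f : E)
    (h : ∀ k : ℕ, |ℓ ((A ^ k) f)| ≤ a ^ k * C) {s : ℝ} (hs : 0 ≤ s) :
    |ℓ (expFlow (A - a • 1) s f)| ≤ C := by
  let +nondep : NormedAlgebra ℚ (E →L[ℝ] E) := NormedAlgebra.restrictScalars ℚ ℝ _
  have hcomm : Commute (s • A) (-(s * a) • (1 : E →L[ℝ] E)) :=
    (Commute.one_right _).smul_right _
  have h1 : s • (A - a • 1) = s • A + (-(s * a)) • (1 : E →L[ℝ] E) := by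
    rw [smul_sub, smul_smul, neg_smul, sub_eq_add_neg]
  have h2 : NormedSpace.exp ((-(s * a)) • (1 : E →L[ℝ] E)) = Real.exp (-(s * a)) • 1 := by
    have := NormedSpace.algebraMap_exp_comm (𝕂 := ℝ) (𝔸 := E →L[ℝ] E) (-(s * a))
    rw [Algebra.algebraMap_eq_smul_one, Algebra.algebraMap_eq_smul_one] at this
    rw [← this, Real.exp_eq_exp_ℝ]
  rw [expFlow, h1, NormedSpace.exp_add_of_commute hcomm, h2]
  have h3 : HasSum (fun k : ℕ => ((k.factorial : ℝ)⁻¹) * (s ^ k * ℓ ((A ^ k) f)))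
      (ℓ (NormedSpace.exp (s • A) f)) := by
    have := NormedSpace.exp_series_hasSum_exp' (𝕂 := ℝ) (s • A)
    have h4 := (this.mapL (ContinuousLinearMap.apply ℝ E f)).mapL ℓ
    simpa [smul_pow] using h4
  have h5 : HasSum (fun k : ℕ => ((k.factorial : ℝ)⁻¹) * ((s * a) ^ k) * C)
      (Real.exp (s * a) * C) := by
    have := NormedSpace.exp_series_hasSum_exp' (𝕂 := ℝ) (s * a)
    rw [Real.exp_eq_exp_ℝ]
    simpa using this.mul_right C
  have h6 : |ℓ (NormedSpace.exp (s • A) f)| ≤ Real.exp (s * a) * C := by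
    rw [← Real.norm_eq_abs]
    refine h3.norm_le_of_bounded h5 fun k => ?_
    rw [Real.norm_eq_abs, abs_mul, abs_mul,
      abs_of_nonneg (by positivity : (0:ℝ) ≤ (k.factorial : ℝ)⁻¹),
      abs_of_nonneg (pow_nonneg hs k), mul_pow, mul_assoc, mul_assoc]
    gcongr
    exact h k
  have h7 : ℓ ((NormedSpace.exp (s • A) * Real.exp (-(s * a)) • (1 : E →L[ℝ] E)) f)
      = Real.exp (-(s * a)) * ℓ (NormedSpace.exp (s • A) f) := by simp
  rw [h7, abs_mul, abs_of_pos (Real.exp_pos _)]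
  calc Real.exp (-(s * a)) * |ℓ (NormedSpace.exp (s • A) f)|
      ≤ Real.exp (-(s * a)) * (Real.exp (s * a) * C) := by gcongr
    _ = C := by rw [← mul_assoc, ← Real.exp_add]; simp

/-- Evaluation at a configuration. -/
noncomputable def evalAt (η : Config) : Obs →L[ℝ] ℝ := BoundedContinuousFunction.evalCLM ℝ η

lemma evalAt_apply (η : Config) (f : Obs) : evalAt η f = f η := rfl

/-- The semigroup of the volume `box R` with reservoirs. -/
noncomputable def reservoirSemigroup (c : ℤ → ℝ) (φ : ℝ) (R : ℕ) (s : ℝ) : Obs →L[ℝ] Obs :=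
  expFlow (reservoirGen c φ R) s

lemma dependsOn_reservoirSemigroup {c : ℤ → ℝ} {φ : ℝ} {R : ℕ} {f : Obs}
    (hf : DependsOn f (box R : Set ℤ)) {s : ℝ} (hs : 0 ≤ s) :
    DependsOn (reservoirSemigroup c φ R s f) (box R : Set ℤ) := by
  intro η ζ h
  have hk : ∀ k : ℕ, DependsOn ((sumOp c φ R ^ k) f) (box R : Set ℤ) := by
    intro k
    induction k with
    | zero => simpa using hf
    | succ k ih => rw [pow_succ']; exact dependsOn_sumOp ih
  have := abs_apply_exp_le (sumOp c φ R) (a := totalRate c R) (C := 0)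
    (evalAt η - evalAt ζ) f (fun k => by
      rw [sub_apply, evalAt_apply, evalAt_apply, hk k h]; simp) hs
  have h0 : (evalAt η - evalAt ζ) (reservoirSemigroup c φ R s f) = 0 := by
    exact abs_nonpos_iff.1 this
  simpa [evalAt_apply, sub_eq_zero] using h0

/-! ### Propagation of a discrepancy -/

/-- The change in `f` caused by one extra particle at `x`. -/
def discrepancy (Λ : Finset ℤ) (x : ℤ) (f : Obs) (η : Config) : ℝ := f (addIn Λ x η) - f η

lemma discrepancy_of_notMem {Λ : Finset ℤ} {x : ℤ} (h : x ∉ Λ) (f : Obs) (η : Config) :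
    discrepancy Λ x f η = 0 := by
  simp [discrepancy, addIn_of_notMem h]

/-- An extra particle at `x` is pushed by a jump from `z` only if `z = x` and `x` is otherwise
empty. -/
lemma abs_discrepancy_jumpOp_le {φ : ℝ} (h0 : 0 ≤ φ) (h1 : φ ≤ 1) {Λ : Finset ℤ} {x z : ℤ} (y : ℤ)
    (hx : x ∈ Λ) {f : Obs} {η : Config} (h : z ≠ x ∨ η x ≠ 0) {b : ℝ}
    (hb : ∀ ζ, |discrepancy Λ x f ζ| ≤ b) :
    |discrepancy Λ x (jumpOp φ Λ z y f) η| ≤ b := by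
  by_cases hz : z = x
  · subst hz
    have hη : η z ≠ 0 := by simpa using h
    have hr : rateIn φ Λ z η = 1 := by simp [rateIn, hx, unitRate, hη]
    have : discrepancy Λ z (jumpOp φ Λ z y f) η
        = discrepancy Λ z f (addIn Λ y (removeIn Λ z η)) := by
      simp only [discrepancy, jumpOp_apply, rateIn_addIn_self φ hx, hr, removeIn_addIn_self]
      rw [addIn_comm Λ z y, addIn_removeIn_self fun _ => hη]
      ring
    rw [this]
    exact hb _
  · have : discrepancy Λ x (jumpOp φ Λ z y f) η
        = (1 - rateIn φ Λ z η) * discrepancy Λ x f η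
          + rateIn φ Λ z η * discrepancy Λ x f (addIn Λ y (removeIn Λ z η)) := by
      simp only [discrepancy, jumpOp_apply, rateIn_addIn_of_ne φ Λ hz, removeIn_addIn_of_ne Λ hz]
      rw [addIn_comm Λ y x]
      ring
    have hr0 := rateIn_nonneg h0 Λ z η
    have hr1 := rateIn_le_one h1 Λ z η
    rw [this]
    refine (abs_add_le _ _).trans ?_
    rw [abs_mul, abs_mul, abs_of_nonneg hr0, abs_of_nonneg (sub_nonneg.2 hr1)]
    have e1 := mul_le_mul_of_nonneg_left (hb η) (sub_nonneg.2 hr1)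
    have e2 := mul_le_mul_of_nonneg_left (hb (addIn Λ y (removeIn Λ z η))) hr0
    linarith

lemma discrepancy_jumpOp_of_eq_zero (φ : ℝ) {Λ : Finset ℤ} {x : ℤ} (y : ℤ) (hx : x ∈ Λ) (f : Obs)
    {η : Config} (h : η x = 0) :
    discrepancy Λ x (jumpOp φ Λ x y f) η = discrepancy Λ y f η := by
  have hr : rateIn φ Λ x η = 0 := by simp [rateIn, hx, unitRate, h]
  simp only [discrepancy, jumpOp_apply, rateIn_addIn_self φ hx, removeIn_addIn_self, hr]
  ring

lemma mem_box {R : ℕ} {x : ℤ} : x ∈ box R ↔ -(R : ℤ) ≤ x ∧ x ≤ R := by simp [box]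

lemma mem_bonds {R : ℕ} {x : ℤ} : x ∈ bonds R ↔ -(R : ℤ) - 1 ≤ x ∧ x ≤ R := by simp [bonds]

/-- A superharmonic weight that dominates the discrepancies of `f` still does so after `sumOp`. -/
lemma abs_discrepancy_sumOp_le {c : ℤ → ℝ} (hc : ∀ x, 0 ≤ c x) {φ : ℝ} (h0 : 0 ≤ φ) (h1 : φ ≤ 1)
    {R : ℕ} {w : ℤ → ℝ} (hw0 : ∀ x ∈ box (R + 1), 0 ≤ w x)
    (hw : ∀ x ∈ box R, c x * (w (x + 1) - w x) + c (x - 1) * (w (x - 1) - w x) ≤ 0)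
    {f : Obs} {C : ℝ} (hC : 0 ≤ C)
    (hf : ∀ x ∈ box (R + 1), ∀ η, |discrepancy (box R) x f η| ≤ C * w x) :
    ∀ x ∈ box (R + 1), ∀ η,
      |discrepancy (box R) x (sumOp c φ R f) η| ≤ totalRate c R * (C * w x) := by
  intro x hx' η
  have htot : 0 ≤ totalRate c R := Finset.sum_nonneg fun y _ => mul_nonneg zero_le_two (hc y)
  by_cases hx : x ∈ box R
  swap
  · rw [discrepancy_of_notMem hx, abs_zero]
    exact mul_nonneg htot (mul_nonneg hC (hw0 x hx'))
  have hxx := mem_box.1 hx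
  have hsum : discrepancy (box R) x (sumOp c φ R f) η = ∑ y ∈ bonds R, c y *
      (discrepancy (box R) x (jumpOp φ (box R) y (y + 1) f) η
        + discrepancy (box R) x (jumpOp φ (box R) (y + 1) y f) η) := by
    simp only [discrepancy, sumOp_apply]
    rw [← Finset.sum_sub_distrib]
    exact Finset.sum_congr rfl fun y _ => by ring
  have key : ∀ y, |c y * (discrepancy (box R) x (jumpOp φ (box R) y (y + 1) f) η
        + discrepancy (box R) x (jumpOp φ (box R) (y + 1) y f) η)|
      ≤ c y * (|discrepancy (box R) x (jumpOp φ (box R) y (y + 1) f) η|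
        + |discrepancy (box R) x (jumpOp φ (box R) (y + 1) y f) η|) := fun y => by
    rw [abs_mul, abs_of_nonneg (hc y)]
    exact mul_le_mul_of_nonneg_left (abs_add_le _ _) (hc y)
  rw [hsum]
  refine (Finset.abs_sum_le_sum_abs _ _).trans ((Finset.sum_le_sum fun y _ => key y).trans ?_)
  by_cases hη : η x = 0
  swap
  · rw [totalRate, Finset.sum_mul]
    refine Finset.sum_le_sum fun y _ => ?_
    have e1 := abs_discrepancy_jumpOp_le h0 h1 (z := y) (y + 1) hx (Or.inr hη) (hf x hx')
    have e2 := abs_discrepancy_jumpOp_le h0 h1 (z := y + 1) y hx (Or.inr hη) (hf x hx')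
    nlinarith [hc y]
  -- the two bonds at `x` are the ones along which the extra particle may move
  have hb : ∀ y ∈ bonds R, c y * (|discrepancy (box R) x (jumpOp φ (box R) y (y + 1) f) η|
        + |discrepancy (box R) x (jumpOp φ (box R) (y + 1) y f) η|)
      ≤ 2 * c y * (C * w x) + ((if y = x then C * (c x * (w (x + 1) - w x)) else 0)
        + (if y = x - 1 then C * (c (x - 1) * (w (x - 1) - w x)) else 0)) := by
    intro y _
    have e1 : |discrepancy (box R) x (jumpOp φ (box R) y (y + 1) f) η|
        ≤ C * w x + if y = x then C * (w (x + 1) - w x) else 0 := by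
      by_cases hy : y = x
      · subst hy
        rw [discrepancy_jumpOp_of_eq_zero φ _ hx f hη, if_pos rfl]
        have := hf (y + 1) (mem_box.2 (by push_cast; omega)) η
        linarith
      · rw [if_neg hy, add_zero]
        exact abs_discrepancy_jumpOp_le h0 h1 _ hx (Or.inl hy) (hf x hx')
    have e2 : |discrepancy (box R) x (jumpOp φ (box R) (y + 1) y f) η|
        ≤ C * w x + if y = x - 1 then C * (w (x - 1) - w x) else 0 := by
      by_cases hy : y = x - 1
      · subst hy
        rw [sub_add_cancel, discrepancy_jumpOp_of_eq_zero φ _ hx f hη, if_pos rfl]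
        have := hf (x - 1) (mem_box.2 (by push_cast; omega)) η
        linarith
      · rw [if_neg hy, add_zero]
        exact abs_discrepancy_jumpOp_le h0 h1 _ hx (Or.inl fun h => hy (by omega)) (hf x hx')
    refine (mul_le_mul_of_nonneg_left (add_le_add e1 e2) (hc y)).trans (le_of_eq ?_)
    by_cases i1 : y = x
    · have i2 : y ≠ x - 1 := by omega
      rw [if_pos i1, if_neg i2, if_pos i1, if_neg i2, i1]; ring
    by_cases i2 : y = x - 1
    · rw [if_neg i1, if_pos i2, if_neg i1, if_pos i2, i2]; ring
    · rw [if_neg i1, if_neg i2, if_neg i1, if_neg i2]; ring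
  refine (Finset.sum_le_sum hb).trans ?_
  rw [Finset.sum_add_distrib, Finset.sum_add_distrib, Finset.sum_ite_eq', Finset.sum_ite_eq',
    if_pos (mem_bonds.2 (by omega)), if_pos (mem_bonds.2 (by omega)), ← Finset.sum_mul,
    ← mul_add]
  have := mul_le_mul_of_nonneg_left (hw x hx) hC
  rw [totalRate]
  linarith

lemma abs_discrepancy_reservoirSemigroup_le {c : ℤ → ℝ} (hc : ∀ x, 0 ≤ c x) {φ : ℝ} (h0 : 0 ≤ φ)
    (h1 : φ ≤ 1) {R : ℕ} {w : ℤ → ℝ} (hw0 : ∀ x ∈ box (R + 1), 0 ≤ w x)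
    (hw : ∀ x ∈ box R, c x * (w (x + 1) - w x) + c (x - 1) * (w (x - 1) - w x) ≤ 0)
    {f : Obs} {C : ℝ} (hC : 0 ≤ C)
    (hf : ∀ x ∈ box (R + 1), ∀ η, |discrepancy (box R) x f η| ≤ C * w x) {s : ℝ} (hs : 0 ≤ s) :
    ∀ x ∈ box (R + 1), ∀ η,
      |discrepancy (box R) x (reservoirSemigroup c φ R s f) η| ≤ C * w x := by
  intro x hx η
  have htot : 0 ≤ totalRate c R := Finset.sum_nonneg fun y _ => mul_nonneg zero_le_two (hc y)
  have hk : ∀ k : ℕ, ∀ x ∈ box (R + 1), ∀ η,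
      |discrepancy (box R) x ((sumOp c φ R ^ k) f) η| ≤ (totalRate c R ^ k * C) * w x := by
    intro k
    induction k with
    | zero => simpa using hf
    | succ k ih =>
      intro x hx η
      rw [pow_succ', pow_succ']
      refine (abs_discrepancy_sumOp_le hc h0 h1 hw0 hw (by positivity) ih x hx η).trans
        (le_of_eq (by ring))
  refine abs_apply_exp_le (sumOp c φ R) (a := totalRate c R)
    (evalAt (addIn (box R) x η) - evalAt η) f (fun k => ?_) hs
  have := hk k x hx η
  rw [mul_assoc] at this
  exact this

/-! ### Comparison of the infinite system with a finite volume -/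

/-- Nearest-neighbour jump rates with conductance `c x` on the bond `{x, x + 1}`. -/
noncomputable def bondRate (c : ℤ → ℝ) (x y : ℤ) : ℝ :=
  if y = x + 1 then c x else if x = y + 1 then c y else 0

lemma apply_jump_eq {R : ℕ} {f : Obs} (hf : DependsOn f (box R : Set ℤ)) {Λ : Finset ℤ}
    (hΛ : box R ⊆ Λ) (x y : ℤ) (η : Config) :
    f (addIn Λ y (removeIn Λ x η)) = f (addIn (box R) y (removeIn (box R) x η)) :=
  (hf (addIn_removeIn_congr (fun _ _ => rfl) Λ hΛ x y)).symm

lemma apply_jump_of_notMem {R : ℕ} {f : Obs} (hf : DependsOn f (box R : Set ℤ)) {Λ : Finset ℤ}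
    (hΛ : box R ⊆ Λ) {x y : ℤ} (hx : x ∉ box R) (hy : y ∉ box R) (η : Config) :
    f (addIn Λ y (removeIn Λ x η)) = f η := by
  rw [apply_jump_eq hf hΛ, addIn_of_notMem hy, removeIn, if_neg hx]

lemma apply_move_of_notMem {R : ℕ} {f : Obs} (hf : DependsOn f (box R : Set ℤ)) {x y : ℤ}
    (hx : x ∉ box R) (hy : y ∉ box R) (η : Config) : f (move x y η) = f η := by
  refine hf fun i hi => ?_
  have h1 : i ≠ x := fun h => hx (h ▸ hi)
  have h2 : i ≠ y := fun h => hy (h ▸ hi)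
  simp [move, h1, h2]

lemma addIn_removeIn_eq_move {Λ : Finset ℤ} {x y : ℤ} (hx : x ∈ Λ) (hy : y ∈ Λ) (hxy : x ≠ y)
    (η : Config) : addIn Λ y (removeIn Λ x η) = move x y η := by
  funext z
  simp only [addIn, removeIn, if_pos hx, if_pos hy, move, Function.update_apply]
  by_cases h1 : z = x
  · subst h1; simp [hxy]
  · by_cases h2 : z = y
    · subst h2; simp [h1]
    · simp [h1, h2]

lemma box_subset {M R : ℕ} (h : M ≤ R) : box M ⊆ box R := fun x hx => by
  rw [mem_box] at hx ⊢; omega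

/-- On observables of `box R`, the generator of the infinite system is that of the volume
`box (R + 1)` with reservoirs, since the reservoirs do not touch `box R` directly. -/
lemma generator_bondRate (c : ℤ → ℝ) (φ : ℝ) {R : ℕ} {f : Obs}
    (hf : DependsOn f (box R : Set ℤ)) (η : Config) :
    generator (bondRate c) unitRate f η = reservoirGen c φ (R + 1) f η := by
  set A : ℤ → ℝ := fun x => c x * unitRate (η x) * (f (move x (x + 1) η) - f η) with hA
  set B : ℤ → ℝ := fun x => c x * unitRate (η (x + 1)) * (f (move (x + 1) x η) - f η) with hB
  have hin : ∀ x : ℤ, ∑' y : ℤ, bondRate c x y * unitRate (η x) * (f (move x y η) - f η)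
      = A x + B (x - 1) := by
    intro x
    rw [tsum_eq_sum (s := {x + 1, x - 1})]
    · rw [Finset.sum_pair (by omega)]
      have h1 : bondRate c x (x + 1) = c x := by simp [bondRate]
      have h2 : bondRate c x (x - 1) = c (x - 1) := by
        unfold bondRate
        rw [if_neg (by omega), if_pos (by omega)]
      simp [h1, h2, hA, hB]
    · intro y hy
      simp only [Finset.mem_insert, Finset.mem_singleton, not_or] at hy
      have : bondRate c x y = 0 := by
        unfold bondRate
        rw [if_neg hy.1, if_neg (by omega)]
      simp [this]
  have hz : ∀ x ∉ bonds R, x ∉ box R ∧ x + 1 ∉ box R := by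
    intro x hx
    rw [mem_bonds] at hx
    rw [mem_box, mem_box]
    omega
  have hA0 : ∀ x ∉ bonds R, A x = 0 := fun x hx => by
    simp [hA, apply_move_of_notMem hf (hz x hx).1 (hz x hx).2]
  have hB0 : ∀ x ∉ bonds R, B x = 0 := fun x hx => by
    simp [hB, apply_move_of_notMem hf (hz x hx).2 (hz x hx).1]
  have hsub : bonds R ⊆ bonds (R + 1) := fun x hx => by
    rw [mem_bonds] at hx ⊢; push_cast; omega
  have hgen : generator (bondRate c) unitRate f η = ∑ x ∈ bonds (R + 1), (A x + B x) := by
    have sA : Summable A := summable_of_ne_finset_zero hA0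
    have sB : Summable B := summable_of_ne_finset_zero hB0
    have e : ∑' x : ℤ, B (x - 1) = ∑' x : ℤ, B x := (Equiv.subRight (1 : ℤ)).tsum_eq B
    rw [generator]
    simp_rw [hin]
    have sB' : Summable fun x => B (x - 1) := (Equiv.subRight (1 : ℤ)).summable_iff.2 sB
    rw [sA.tsum_add sB', e,
      tsum_eq_sum (s := bonds (R + 1)) fun x hx => hA0 x fun h => hx (hsub h),
      tsum_eq_sum (s := bonds (R + 1)) fun x hx => hB0 x fun h => hx (hsub h),
      Finset.sum_add_distrib]
  rw [hgen, reservoirGen_apply]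
  refine Finset.sum_congr rfl fun x _ => ?_
  have hbox := box_subset (Nat.le_succ R)
  by_cases hx : x ∈ bonds R
  · rw [mem_bonds] at hx
    have h1 : x ∈ box (R + 1) := mem_box.2 (by push_cast; omega)
    have h2 : x + 1 ∈ box (R + 1) := mem_box.2 (by push_cast; omega)
    rw [addIn_removeIn_eq_move h1 h2 (by omega), addIn_removeIn_eq_move h2 h1 (by omega)]
    simp only [rateIn, h1, h2, if_true, hA, hB]
    ring
  · rw [hA0 x hx, hB0 x hx, apply_jump_of_notMem hf hbox (hz x hx).1 (hz x hx).2,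
      apply_jump_of_notMem hf hbox (hz x hx).2 (hz x hx).1]
    ring

/-- Enlarging the volume changes the generator only through the discrepancies at the ends. -/
lemma abs_reservoirGen_succ_sub_le {c : ℤ → ℝ} (hc : ∀ x, 0 ≤ c x) {φ : ℝ} (h0 : 0 ≤ φ)
    (h1 : φ ≤ 1) {R : ℕ} {f : Obs} (hf : DependsOn f (box R : Set ℤ)) (η : Config) :
    |reservoirGen c φ (R + 1) f η - reservoirGen c φ R f η|
      ≤ c R * |discrepancy (box R) R f η|
        + c (-(R : ℤ) - 1) * |discrepancy (box R) (-(R : ℤ)) f η| := by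
  have hbox := box_subset (Nat.le_succ R)
  have hsub : bonds R ⊆ bonds (R + 1) := fun x hx => by
    rw [mem_bonds] at hx ⊢; push_cast; omega
  have hrate : ∀ x, |rateIn φ (box (R + 1)) x η - rateIn φ (box R) x η|
      ≤ if x ∈ box R then 0 else 1 := by
    intro x
    split_ifs with hx
    · simp [rateIn, hx, hbox hx]
    · have a1 := rateIn_nonneg h0 (box (R + 1)) x η
      have a2 := rateIn_le_one h1 (box (R + 1)) x η
      have a3 := rateIn_nonneg h0 (box R) x η
      have a4 := rateIn_le_one h1 (box R) x η
      rw [abs_le]; constructor <;> linarith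
  have e1 : reservoirGen c φ (R + 1) f η = ∑ x ∈ bonds R, c x *
      (rateIn φ (box (R + 1)) x η * (f (addIn (box R) (x + 1) (removeIn (box R) x η)) - f η) +
       rateIn φ (box (R + 1)) (x + 1) η *
        (f (addIn (box R) x (removeIn (box R) (x + 1) η)) - f η)) := by
    rw [reservoirGen_apply]
    simp_rw [apply_jump_eq hf hbox]
    symm
    refine Finset.sum_subset hsub fun x _ hx => ?_
    rw [mem_bonds] at hx
    have n1 : x ∉ box R := by rw [mem_box]; omega
    have n2 : x + 1 ∉ box R := by rw [mem_box]; omega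
    simp [addIn, removeIn, n1, n2]
  rw [e1, reservoirGen_apply, ← Finset.sum_sub_distrib]
  have key : ∀ x ∈ bonds R, |c x *
      (rateIn φ (box (R + 1)) x η * (f (addIn (box R) (x + 1) (removeIn (box R) x η)) - f η) +
       rateIn φ (box (R + 1)) (x + 1) η *
        (f (addIn (box R) x (removeIn (box R) (x + 1) η)) - f η)) - c x *
      (rateIn φ (box R) x η * (f (addIn (box R) (x + 1) (removeIn (box R) x η)) - f η) +
       rateIn φ (box R) (x + 1) η *
        (f (addIn (box R) x (removeIn (box R) (x + 1) η)) - f η))|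
      ≤ (if x = R then c R * |discrepancy (box R) R f η| else 0) +
        (if x = -(R : ℤ) - 1 then
          c (-(R : ℤ) - 1) * |discrepancy (box R) (-(R : ℤ)) f η| else 0) := by
    intro x hx
    rw [mem_bonds] at hx
    have eq : ∀ a a' b b' u v : ℝ, c x * (a * u + b * v) - c x * (a' * u + b' * v)
        = c x * ((a - a') * u + (b - b') * v) := fun _ _ _ _ _ _ => by ring
    rw [eq, abs_mul, abs_of_nonneg (hc x)]
    have hA : |(rateIn φ (box (R + 1)) x η - rateIn φ (box R) x η) *
        (f (addIn (box R) (x + 1) (removeIn (box R) x η)) - f η)|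
        ≤ if x = -(R : ℤ) - 1 then |discrepancy (box R) (-(R : ℤ)) f η| else 0 := by
      rw [abs_mul]
      have := hrate x
      by_cases h : x = -(R : ℤ) - 1
      · have n1 : x ∉ box R := by rw [mem_box]; omega
        rw [if_neg n1] at this
        rw [if_pos h, removeIn, if_neg n1, show x + 1 = -(R : ℤ) by omega]
        exact (mul_le_mul_of_nonneg_right this (abs_nonneg _)).trans (one_mul _).le
      · rw [if_pos (mem_box.2 (by omega))] at this
        rw [if_neg h, abs_nonpos_iff.1 this]
        simp
    have hB : |(rateIn φ (box (R + 1)) (x + 1) η - rateIn φ (box R) (x + 1) η) *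
        (f (addIn (box R) x (removeIn (box R) (x + 1) η)) - f η)|
        ≤ if x = R then |discrepancy (box R) R f η| else 0 := by
      rw [abs_mul]
      have := hrate (x + 1)
      by_cases h : x = R
      · have n1 : x + 1 ∉ box R := by rw [mem_box]; omega
        rw [if_neg n1] at this
        subst h
        rw [if_pos rfl, removeIn, if_neg n1]
        exact (mul_le_mul_of_nonneg_right this (abs_nonneg _)).trans (one_mul _).le
      · rw [if_pos (mem_box.2 (by omega))] at this
        rw [if_neg h, abs_nonpos_iff.1 this]
        simp
    refine (mul_le_mul_of_nonneg_left ((abs_add_le _ _).trans (add_le_add hA hB)) (hc x)).trans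
      (le_of_eq ?_)
    by_cases i1 : x = R
    · have i2 : x ≠ -(R : ℤ) - 1 := by omega
      rw [if_pos i1, if_neg i2, if_pos i1, if_neg i2, i1]; ring
    by_cases i2 : x = -(R : ℤ) - 1
    · rw [if_neg i1, if_pos i2, if_neg i1, if_pos i2, i2]; ring
    · rw [if_neg i1, if_neg i2, if_neg i1, if_neg i2]; ring
  refine (Finset.abs_sum_le_sum_abs _ _).trans ((Finset.sum_le_sum key).trans (le_of_eq ?_))
  rw [Finset.sum_add_distrib, Finset.sum_ite_eq', Finset.sum_ite_eq',
    if_pos (mem_bonds.2 (by omega)), if_pos (mem_bonds.2 (by omega))]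

/-- The conductance of the bond `{x, x + 1}` whose resistance is the increment of `S`. -/
noncomputable def conductance (S : ℤ → ℝ) (x : ℤ) : ℝ := (S (x + 1) - S x)⁻¹

lemma conductance_pos {S : ℤ → ℝ} (hS : StrictMono S) (x : ℤ) : 0 < conductance S x :=
  inv_pos.2 (sub_pos.2 (hS (by omega)))

/-- The probability that the random walk started at `x` hits `box M` before it leaves `box R`,
written as a minimum of `1` and two affine functions of the scale `S`. -/
noncomputable def weight (S : ℤ → ℝ) (M R : ℕ) (x : ℤ) : ℝ :=
  min 1 (min ((S (R + 1) - S x) / (S (R + 1) - S M))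
    ((S x - S (-(R : ℤ) - 1)) / (S (-(M : ℤ)) - S (-(R : ℤ) - 1))))

lemma weight_nonneg {S : ℤ → ℝ} (hS : StrictMono S) {M R : ℕ} (hMR : M ≤ R) {x : ℤ}
    (hx : x ∈ box (R + 1)) : 0 ≤ weight S M R x := by
  rw [mem_box] at hx
  push_cast at hx
  refine le_min zero_le_one (le_min (div_nonneg ?_ ?_) (div_nonneg ?_ ?_)) <;>
    exact sub_nonneg.2 (hS.monotone (by omega))

lemma weight_eq_one {S : ℤ → ℝ} (hS : StrictMono S) {M R : ℕ} (hMR : M ≤ R) {x : ℤ}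
    (hx : x ∈ box M) : weight S M R x = 1 := by
  rw [mem_box] at hx
  refine min_eq_left (le_min ?_ ?_)
  · rw [le_div_iff₀ (sub_pos.2 (hS (by omega)))]
    have := hS.monotone hx.2
    linarith
  · rw [le_div_iff₀ (sub_pos.2 (hS (by omega)))]
    have := hS.monotone hx.1
    linarith

/-- A minimum of functions that are affine in the scale `S` is superharmonic. -/
lemma weight_superharmonic {S : ℤ → ℝ} (hS : StrictMono S) (M R : ℕ) (x : ℤ) :
    conductance S x * (weight S M R (x + 1) - weight S M R x)
      + conductance S (x - 1) * (weight S M R (x - 1) - weight S M R x) ≤ 0 := by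
  have key : ∀ a b : ℝ, (∀ y, weight S M R y ≤ a + b * S y) → weight S M R x = a + b * S x →
      conductance S x * (weight S M R (x + 1) - weight S M R x)
      + conductance S (x - 1) * (weight S M R (x - 1) - weight S M R x) ≤ 0 := by
    intro a b h e
    have h1 := mul_le_mul_of_nonneg_left (h (x + 1)) (conductance_pos hS x).le
    have h2 := mul_le_mul_of_nonneg_left (h (x - 1)) (conductance_pos hS (x - 1)).le
    have e1 : conductance S x * (S (x + 1) - S x) = 1 :=
      inv_mul_cancel₀ (sub_pos.2 (hS (by omega))).ne'
    have e2 : conductance S (x - 1) * (S x - S (x - 1)) = 1 := by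
      have : S (x - 1) < S x := hS (by omega)
      rw [conductance, sub_add_cancel]
      exact inv_mul_cancel₀ (sub_pos.2 this).ne'
    rw [e]
    linear_combination h1 + h2 + b * e1 - b * e2
  rcases min_choice 1 (min ((S (R + 1) - S x) / (S (R + 1) - S M))
    ((S x - S (-(R : ℤ) - 1)) / (S (-(M : ℤ)) - S (-(R : ℤ) - 1)))) with h | h
  · refine key 1 0 (fun y => ?_) (by rw [weight, h]; ring)
    rw [zero_mul, add_zero]
    exact min_le_left _ _
  rcases min_choice ((S (R + 1) - S x) / (S (R + 1) - S M))
    ((S x - S (-(R : ℤ) - 1)) / (S (-(M : ℤ)) - S (-(R : ℤ) - 1))) with h' | h'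
  · refine key (S (R + 1) / (S (R + 1) - S M)) (-1 / (S (R + 1) - S M)) (fun y => ?_)
      (by rw [weight, h, h']; ring)
    refine ((min_le_right _ _).trans (min_le_left _ _)).trans (le_of_eq (by ring))
  · refine key (-S (-(R : ℤ) - 1) / (S (-(M : ℤ)) - S (-(R : ℤ) - 1)))
      (1 / (S (-(M : ℤ)) - S (-(R : ℤ) - 1))) (fun y => ?_) (by rw [weight, h, h']; ring)
    refine ((min_le_right _ _).trans (min_le_right _ _)).trans (le_of_eq (by ring))

/-- The sum of the effective conductances between `box M` and the reservoirs at the two ends of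
`box R`. -/
noncomputable def leak (S : ℤ → ℝ) (M R : ℕ) : ℝ :=
  (S (R + 1) - S M)⁻¹ + (S (-(M : ℤ)) - S (-(R : ℤ) - 1))⁻¹

lemma flux_weight_le {S : ℤ → ℝ} (hS : StrictMono S) (M R : ℕ) :
    conductance S R * weight S M R R
      + conductance S (-(R : ℤ) - 1) * weight S M R (-(R : ℤ)) ≤ leak S M R := by
  refine add_le_add ?_ ?_
  · calc conductance S R * weight S M R R
        ≤ conductance S R * ((S (R + 1) - S R) / (S (R + 1) - S M)) :=
          mul_le_mul_of_nonneg_left ((min_le_right _ _).trans (min_le_left _ _))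
            (conductance_pos hS _).le
      _ = (S (R + 1) - S M)⁻¹ := by
          have : S (R + 1) - S R ≠ 0 := (sub_pos.2 (hS (by omega))).ne'
          rw [conductance, div_eq_mul_inv, inv_mul_cancel_left₀ this]
  · calc conductance S (-(R : ℤ) - 1) * weight S M R (-(R : ℤ))
        ≤ conductance S (-(R : ℤ) - 1) *
          ((S (-(R : ℤ)) - S (-(R : ℤ) - 1)) / (S (-(M : ℤ)) - S (-(R : ℤ) - 1))) :=
          mul_le_mul_of_nonneg_left ((min_le_right _ _).trans (min_le_right _ _))
            (conductance_pos hS _).le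
      _ = (S (-(M : ℤ)) - S (-(R : ℤ) - 1))⁻¹ := by
          have : S (-(R : ℤ)) - S (-(R : ℤ) - 1) ≠ 0 := (sub_pos.2 (hS (by omega))).ne'
          rw [conductance, sub_add_cancel, div_eq_mul_inv, inv_mul_cancel_left₀ this]

/-- The ends of `box R` are far away in resistance: this is where the divergence of the scale at
both infinities enters. -/
lemma tendsto_leak {S : ℤ → ℝ} (hTop : Tendsto S atTop atTop) (hBot : Tendsto S atBot atBot)
    (M : ℕ) : Tendsto (leak S M) atTop (𝓝 0) := by
  have h1 : Tendsto (fun R : ℕ => (S (R + 1) - S M)⁻¹) atTop (𝓝 0) := by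
    refine Tendsto.inv_tendsto_atTop (tendsto_atTop_add_const_right _ _ (hTop.comp ?_))
    exact tendsto_atTop_add_const_right _ _ tendsto_natCast_atTop_atTop
  have h2 : Tendsto (fun R : ℕ => (S (-(M : ℤ)) - S (-(R : ℤ) - 1))⁻¹) atTop (𝓝 0) := by
    refine Tendsto.inv_tendsto_atTop ?_
    simp_rw [sub_eq_add_neg (S (-(M : ℤ)))]
    refine tendsto_atTop_add_const_left _ _ (tendsto_neg_atBot_atTop.comp (hBot.comp ?_))
    refine tendsto_atBot_add_const_right _ _ (tendsto_neg_atTop_atBot.comp ?_)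
    exact tendsto_natCast_atTop_atTop
  rw [← add_zero (0 : ℝ)]
  exact h1.add h2

/-- The generator of the infinite system and that of a large finite volume almost agree along the
semigroup of the latter, when it starts from a local observable. -/
lemma abs_generator_sub_reservoirGen_le {S : ℤ → ℝ} (hS : StrictMono S) {φ : ℝ} (h0 : 0 ≤ φ)
    (h1 : φ ≤ 1) {M R : ℕ} (hMR : M ≤ R) {f : Obs} (hf : DependsOn f (box M : Set ℤ)) {s : ℝ}
    (hs : 0 ≤ s) (η : Config) :
    |reservoirGen (conductance S) φ (R + 1) (reservoirSemigroup (conductance S) φ R s f) η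
      - reservoirGen (conductance S) φ R (reservoirSemigroup (conductance S) φ R s f) η|
      ≤ 2 * ‖f‖ * leak S M R := by
  have hc : ∀ x, 0 ≤ conductance S x := fun x => (conductance_pos hS x).le
  have hfR : DependsOn f (box R : Set ℤ) := fun η ζ h => hf fun i hi => h i (box_subset hMR hi)
  have hC : 0 ≤ 2 * ‖f‖ := by positivity
  have hstart : ∀ x ∈ box (R + 1), ∀ η,
      |discrepancy (box R) x f η| ≤ 2 * ‖f‖ * weight S M R x := by
    intro x hx η
    by_cases hxM : x ∈ box M
    · rw [weight_eq_one hS hMR hxM, mul_one, discrepancy]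
      have a1 := f.norm_coe_le_norm (addIn (box R) x η)
      have a2 := f.norm_coe_le_norm η
      rw [← Real.norm_eq_abs]
      refine (norm_sub_le _ _).trans (by linarith)
    · have : discrepancy (box R) x f η = 0 := by
        rw [discrepancy, sub_eq_zero]
        refine hf fun i hi => ?_
        have : i ≠ x := fun h => hxM (h ▸ hi)
        unfold addIn
        split_ifs
        · simp [this]
        · rfl
      rw [this, abs_zero]
      exact mul_nonneg hC (weight_nonneg hS hMR hx)
  have hD := abs_discrepancy_reservoirSemigroup_le hc h0 h1 (w := weight S M R)
    (fun x hx => weight_nonneg hS hMR hx) (fun x _ => weight_superharmonic hS M R x) hC hstart hs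
  refine (abs_reservoirGen_succ_sub_le hc h0 h1 (dependsOn_reservoirSemigroup hfR hs) η).trans ?_
  have b1 := mul_le_mul_of_nonneg_left
    (hD R (mem_box.2 (by push_cast; omega)) η) (hc R)
  have b2 := mul_le_mul_of_nonneg_left
    (hD (-(R : ℤ)) (mem_box.2 (by push_cast; omega)) η) (hc (-(R : ℤ) - 1))
  have b3 := mul_le_mul_of_nonneg_left (flux_weight_le hS M R) hC
  linarith

/-! ### Symmetric semigroups and the variational bound -/

section Flow

variable {E : Type*} [NormedAddCommGroup E] [NormedSpace ℝ E]

lemma expFlow_zero (L : E →L[ℝ] E) : expFlow L 0 = 1 := by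
  rw [expFlow, zero_smul, NormedSpace.exp_zero]

variable [CompleteSpace E]

lemma expFlow_add (L : E →L[ℝ] E) (s t : ℝ) : expFlow L (s + t) = expFlow L s * expFlow L t := by
  let +nondep : NormedAlgebra ℚ (E →L[ℝ] E) := NormedAlgebra.restrictScalars ℚ ℝ _
  rw [expFlow, add_smul, NormedSpace.exp_add_of_commute]
  · rfl
  · exact ((Commute.refl L).smul_left _).smul_right _

lemma hasDerivAt_expFlow (L : E →L[ℝ] E) (f : E) (s : ℝ) :
    HasDerivAt (fun s => expFlow L s f) (L (expFlow L s f)) s := by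
  have := (hasDerivAt_exp_smul_const' (𝕂 := ℝ) L s).clm_apply (hasDerivAt_const s f)
  simpa [expFlow] using this

lemma continuous_expFlow (L : E →L[ℝ] E) (f : E) : Continuous fun s => expFlow L s f :=
  continuous_iff_continuousAt.2 fun s => (hasDerivAt_expFlow L f s).continuousAt

/-- The semigroup of a symmetric generator is symmetric. -/
lemma expFlow_symm (B : E →L[ℝ] E →L[ℝ] ℝ) {L : E →L[ℝ] E}
    (hL : ∀ f h, B (L f) h = B f (L h)) (s : ℝ) (f h : E) :
    B (expFlow L s f) h = B f (expFlow L s h) := by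
  have hk : ∀ (k : ℕ) f h, B ((L ^ k) f) h = B f ((L ^ k) h) := by
    intro k
    induction k with
    | zero => simp
    | succ k ih =>
      intro f h
      calc B ((L ^ (k + 1)) f) h = B (L ((L ^ k) f)) h := by rw [pow_succ', mul_apply_eq_comp]
        _ = B f ((L ^ k) (L h)) := by rw [hL, ih]
        _ = B f ((L ^ (k + 1)) h) := by rw [pow_succ, mul_apply_eq_comp]
  have hsum := NormedSpace.exp_series_hasSum_exp' (𝕂 := ℝ) (s • L)
  have h1 := (hsum.mapL (ContinuousLinearMap.apply ℝ E f)).mapL (B.flip h)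
  have h2 := (hsum.mapL (ContinuousLinearMap.apply ℝ E h)).mapL (B f)
  have e : ∀ k : ℕ, B.flip h (ContinuousLinearMap.apply ℝ E f ((k.factorial⁻¹ : ℝ) • (s • L) ^ k))
      = B f (ContinuousLinearMap.apply ℝ E h ((k.factorial⁻¹ : ℝ) • (s • L) ^ k)) := fun k => by
    rw [smul_pow]
    simp only [ContinuousLinearMap.apply_apply, map_smul,
      ContinuousLinearMap.flip_apply, hk]
  simp_rw [e] at h1
  exact h1.unique h2

/-- The time integral of the autocorrelation of `V` under a symmetric semigroup is bounded by the
variational norm `sup_f (2 ⟨V, f⟩ + ⟨f, L f⟩)`. With `Q = ∫₀ˢ e^{τL} V dτ` the claim is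
`⟨V, Q⟩ ≤ K`, and `-⟨Q, L Q⟩ = ⟨Q, V⟩ - ⟨Q, e^{sL} V⟩ ≤ ⟨Q, V⟩`. -/
lemma integral_autocorrelation_le (B : E →L[ℝ] E →L[ℝ] ℝ) (hB : ∀ f h, B f h = B h f)
    (hpos : ∀ f, 0 ≤ B f f) {L : E →L[ℝ] E} (hL : ∀ f h, B (L f) h = B f (L h)) {V : E} {K : ℝ}
    (hV : ∀ f, 2 * B V f + B f (L f) ≤ K) {s : ℝ} (hs : 0 ≤ s) :
    ∫ τ in (0 : ℝ)..s, B V (expFlow L τ V) ≤ K := by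
  have hcont := continuous_expFlow L V
  have hint : IntervalIntegrable (fun τ => expFlow L τ V) volume 0 s :=
    hcont.intervalIntegrable _ _
  set Q : E := ∫ τ in (0 : ℝ)..s, expFlow L τ V with hQ
  have h1 : ∫ τ in (0 : ℝ)..s, B V (expFlow L τ V) = B V Q :=
    (B V).intervalIntegral_comp_comm hint
  have h2 : L Q = expFlow L s V - V := by
    rw [hQ, ← L.intervalIntegral_comp_comm hint,
      intervalIntegral.integral_eq_sub_of_hasDerivAt (fun τ _ => hasDerivAt_expFlow L V τ)
        ((L.continuous.comp hcont).intervalIntegrable _ _), expFlow_zero]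
    rfl
  have h3 : 0 ≤ B Q (expFlow L s V) := by
    rw [hB, hQ, ← (B (expFlow L s V)).intervalIntegral_comp_comm hint]
    refine intervalIntegral.integral_nonneg hs fun τ hτ => ?_
    have e1 : expFlow L s V = expFlow L ((s - τ) / 2) (expFlow L ((s + τ) / 2) V) := by
      rw [← mul_apply_eq_comp, ← expFlow_add]
      congr 2; ring
    have e2 : expFlow L ((s - τ) / 2) (expFlow L τ V) = expFlow L ((s + τ) / 2) V := by
      rw [← mul_apply_eq_comp, ← expFlow_add]
      congr 2; ring
    rw [e1, expFlow_symm B hL, e2]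
    exact hpos _
  have h4 := hV Q
  rw [h2, map_sub, hB Q V] at h4
  rw [h1]
  linarith

end Flow

/-! ### The equilibrium measures -/

lemma rateFactorial_unitRate (n : ℕ) : rateFactorial unitRate n = 1 :=
  Finset.prod_eq_one fun i _ => by simp [unitRate]

lemma criticalFugacity_unitRate : criticalFugacity unitRate = 1 := by
  simp [criticalFugacity, rateFactorial_unitRate]

lemma marginal_unitRate {φ : ℝ} (h0 : 0 ≤ φ) (h1 : φ < 1) :
    marginal unitRate φ
      = Measure.sum fun k : ℕ => ENNReal.ofReal ((1 - φ) * φ ^ k) • Measure.dirac k := by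
  simp only [marginal, partitionFunction, rateFactorial_unitRate, div_one,
    tsum_geometric_of_lt_one h0 h1, inv_inv]

lemma hasSum_geometric_weights {φ : ℝ} (h0 : 0 ≤ φ) (h1 : φ < 1) :
    HasSum (fun k : ℕ => (1 - φ) * φ ^ k) 1 := by
  have := (hasSum_geometric_of_lt_one h0 h1).mul_left (1 - φ)
  rwa [mul_inv_cancel₀ (by linarith)] at this

lemma isProbabilityMeasure_marginal {φ : ℝ} (h0 : 0 ≤ φ) (h1 : φ < 1) :
    IsProbabilityMeasure (marginal unitRate φ) := by
  refine ⟨?_⟩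
  have hn : ∀ k : ℕ, 0 ≤ (1 - φ) * φ ^ k := fun k =>
    mul_nonneg (by linarith) (pow_nonneg h0 k)
  rw [marginal_unitRate h0 h1, Measure.sum_apply _ MeasurableSet.univ]
  have hs := hasSum_geometric_weights h0 h1
  simp only [Measure.smul_apply, smul_eq_mul, measure_univ, mul_one]
  rw [← ENNReal.ofReal_tsum_of_nonneg hn hs.summable, hs.tsum_eq, ENNReal.ofReal_one]

/-- The geometric law loses a factor `φ` when it is shifted by one. -/
lemma marginal_inter_ne_zero {φ : ℝ} (h0 : 0 ≤ φ) (h1 : φ < 1) (T : Set ℕ) :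
    marginal unitRate φ (T ∩ {k | k ≠ 0})
      = ENNReal.ofReal φ * marginal unitRate φ {k | k + 1 ∈ T} := by
  rw [marginal_unitRate h0 h1, Measure.sum_apply _ (MeasurableSet.of_discrete),
    Measure.sum_apply _ (MeasurableSet.of_discrete), tsum_eq_zero_add' ENNReal.summable,
    ← ENNReal.tsum_mul_left]
  simp only [Measure.smul_apply, smul_eq_mul]
  have e0 : (Measure.dirac 0 : Measure ℕ) (T ∩ {k | k ≠ 0}) = 0 := by simp
  rw [e0, mul_zero, zero_add]
  refine tsum_congr fun k => ?_
  have e1 : (Measure.dirac (k + 1) : Measure ℕ) (T ∩ {k | k ≠ 0})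
      = (Measure.dirac k : Measure ℕ) {k | k + 1 ∈ T} := by
    rw [Measure.dirac_apply' _ MeasurableSet.of_discrete,
      Measure.dirac_apply' _ MeasurableSet.of_discrete]
    by_cases h : k + 1 ∈ T
    · have h' : k + 1 ∈ T ∩ {k | k ≠ 0} := ⟨h, Nat.succ_ne_zero k⟩
      rw [Set.indicator_of_mem h', Set.indicator_of_mem (by exact h)]
      rfl
    · have h' : k + 1 ∉ T ∩ {k | k ≠ 0} := fun hk => h hk.1
      rw [Set.indicator_of_notMem h', Set.indicator_of_notMem (by exact h)]
  rw [e1, ← mul_assoc, ← ENNReal.ofReal_mul h0]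
  congr 2
  ring

lemma isProbabilityMeasure_productLaw {φ : ℝ} (h0 : 0 ≤ φ) (h1 : φ < 1) :
    IsProbabilityMeasure (productLaw unitRate φ) := by
  have := isProbabilityMeasure_marginal h0 h1
  unfold productLaw
  infer_instance

lemma density_unitRate {φ : ℝ} (h0 : 0 ≤ φ) (h1 : φ < 1) :
    density unitRate φ = φ / (1 - φ) := by
  have := isProbabilityMeasure_marginal h0 h1
  have hp := measurePreserving_eval_infinitePi (fun _ : ℤ => marginal unitRate φ) 0
  have e1 : density unitRate φ = ∫ k : ℕ, (k : ℝ) ∂(marginal unitRate φ) := by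
    rw [← hp.map_eq, integral_map hp.measurable.aemeasurable
      (Measurable.of_discrete.aestronglyMeasurable)]
    rfl
  have hs : HasSum (fun k : ℕ => (1 - φ) * φ ^ k * k) (φ / (1 - φ)) := by
    have := (hasSum_coe_mul_geometric_of_norm_lt_one (𝕜 := ℝ) (r := φ)
      (by rwa [Real.norm_of_nonneg h0])).mul_left (1 - φ)
    have hne : 1 - φ ≠ 0 := by linarith
    have e : (1 - φ) * (φ / (1 - φ) ^ 2) = φ / (1 - φ) := by field_simp
    rw [e] at this
    have e' : ∀ k : ℕ, (1 - φ) * (k * φ ^ k) = (1 - φ) * φ ^ k * k := fun k => by ring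
    simp_rw [e'] at this
    exact this
  rw [e1, integral_eq_lintegral_of_nonneg_ae (ae_of_all _ fun k => Nat.cast_nonneg k)
    (Measurable.of_discrete.aestronglyMeasurable), marginal_unitRate h0 h1,
    lintegral_sum_measure]
  have hn : ∀ k : ℕ, 0 ≤ (1 - φ) * φ ^ k := fun k =>
    mul_nonneg (by linarith) (pow_nonneg h0 k)
  have e2 : ∀ k : ℕ, ∫⁻ a : ℕ, ENNReal.ofReal (a : ℝ)
      ∂(ENNReal.ofReal ((1 - φ) * φ ^ k) • Measure.dirac k)
      = ENNReal.ofReal ((1 - φ) * φ ^ k * k) := fun k => by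
    rw [lintegral_smul_measure, lintegral_dirac, smul_eq_mul, ENNReal.ofReal_mul (hn k)]
  simp_rw [e2]
  rw [← ENNReal.ofReal_tsum_of_nonneg (fun k => mul_nonneg (hn k) k.cast_nonneg) hs.summable,
    hs.tsum_eq, ENNReal.toReal_ofReal (div_nonneg h0 (by linarith))]

/-- Every positive density is attained by a fugacity in `[0, 1)`, namely `ρ / (1 + ρ)`. -/
lemma fugacity_mem {ρ : ℝ} (hρ : 0 < ρ) :
    0 ≤ fugacity unitRate ρ ∧ fugacity unitRate ρ < 1 := by
  have hne : 1 + ρ ≠ 0 := by positivity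
  have hmem : ∃ φ ∈ {φ : ℝ | 0 ≤ φ ∧ ENNReal.ofReal φ < criticalFugacity unitRate},
      density unitRate φ = ρ := by
    have h0 : 0 ≤ ρ / (1 + ρ) := by positivity
    have h1 : ρ / (1 + ρ) < 1 := (div_lt_one (by positivity)).2 (by linarith)
    refine ⟨ρ / (1 + ρ), ⟨h0, ?_⟩, ?_⟩
    · rw [criticalFugacity_unitRate]
      exact ENNReal.ofReal_lt_one.2 h1
    · rw [density_unitRate h0 h1]
      field_simp
      ring
  have := Function.invFunOn_mem hmem
  refine ⟨this.1, ?_⟩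
  have h := this.2.trans_eq criticalFugacity_unitRate
  exact ENNReal.ofReal_lt_one.1 h

lemma measurableSet_occupied (z : ℤ) : MeasurableSet {η : Config | η z ≠ 0} :=
  (measurable_pi_apply (X := fun _ : ℤ => ℕ) z)
    (MeasurableSet.of_discrete (s := ({k : ℕ | k ≠ 0} : Set ℕ)))

/-- Adding a particle at `z` turns equilibrium, up to the factor `φ`, into equilibrium restricted to
the configurations with a particle at `z`. -/
lemma restrict_productLaw {φ : ℝ} (h0 : 0 ≤ φ) (h1 : φ < 1) {Λ : Finset ℤ} {z : ℤ} (hz : z ∈ Λ) :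
    (productLaw unitRate φ).restrict {η | η z ≠ 0}
      = ENNReal.ofReal φ • (productLaw unitRate φ).map (addIn Λ z) := by
  classical
  have hprob := isProbabilityMeasure_marginal h0 h1
  have := isProbabilityMeasure_productLaw h0 h1
  have hmeas : Measurable (addIn Λ z) := (continuous_addIn Λ z).measurable
  have hbox : ∀ (s : Finset ℤ) (t : ℤ → Set ℕ) (U : Set ℕ), z ∉ s →
      productLaw unitRate φ {η | η z ∈ U ∧ ∀ i ∈ s, η i ∈ t i}
        = marginal unitRate φ U * ∏ i ∈ s, marginal unitRate φ (t i) := by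
    intro s t U hzs
    have e : {η : Config | η z ∈ U ∧ ∀ i ∈ s, η i ∈ t i}
        = ((insert z s : Finset ℤ) : Set ℤ).pi (Function.update t z U) := by
      ext η
      simp only [Set.mem_ofPred_eq, Set.mem_pi, Finset.coe_insert, Set.mem_insert_iff,
        Finset.mem_coe, forall_eq_or_imp, Function.update_self]
      refine and_congr_right fun _ => forall₂_congr fun i hi => ?_
      rw [Function.update_of_ne (ne_of_mem_of_not_mem hi hzs)]
    rw [e, productLaw, Measure.infinitePi_pi _ fun _ _ => MeasurableSet.of_discrete,
      Finset.prod_insert hzs, Function.update_self]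
    congr 1
    refine Finset.prod_congr rfl fun i hi => ?_
    rw [Function.update_of_ne (ne_of_mem_of_not_mem hi hzs)]
  refine ext_of_generate_finite _ (generateFrom_squareCylinders (α := fun _ : ℤ => ℕ)).symm
    (isPiSystem_squareCylinders (fun _ => MeasurableSpace.isPiSystem_measurableSet)
      fun _ => by simp) ?_ ?_
  · rintro C ⟨s, t, -, rfl⟩
    have hC : MeasurableSet ((s : Set ℤ).pi t) :=
      MeasurableSet.pi s.countable_toSet fun _ _ => MeasurableSet.of_discrete
    set T : Set ℕ := {k | z ∈ s → k ∈ t z} with hT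
    have hmem : ∀ η : Config, η ∈ (s : Set ℤ).pi t ↔ η z ∈ T ∧ ∀ i ∈ s.erase z, η i ∈ t i := by
      intro η
      simp only [Set.mem_pi, Finset.mem_coe, hT, Set.mem_ofPred_eq, Finset.mem_erase]
      refine ⟨fun h => ⟨h z, fun i hi => h i hi.2⟩, fun h i hi => ?_⟩
      by_cases hiz : i = z
      · subst hiz; exact h.1 hi
      · exact h.2 i ⟨hiz, hi⟩
    rw [Measure.restrict_apply hC, Measure.smul_apply, Measure.map_apply hmeas hC, smul_eq_mul]
    have e1 : (s : Set ℤ).pi t ∩ {η : Config | η z ≠ 0}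
        = {η | η z ∈ T ∩ {k | k ≠ 0} ∧ ∀ i ∈ s.erase z, η i ∈ t i} := by
      ext η
      rw [Set.mem_inter_iff, hmem]
      simp only [Set.mem_ofPred_eq, Set.mem_inter_iff]
      tauto
    have e2 : addIn Λ z ⁻¹' ((s : Set ℤ).pi t)
        = {η | η z ∈ {k | k + 1 ∈ T} ∧ ∀ i ∈ s.erase z, η i ∈ t i} := by
      ext η
      rw [Set.mem_preimage, hmem]
      simp only [addIn, if_pos hz, Function.update_self, Set.mem_ofPred_eq]
      refine and_congr_right fun _ => forall₂_congr fun i hi => ?_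
      rw [Function.update_of_ne (Finset.ne_of_mem_erase hi)]
    rw [e1, e2, hbox _ _ _ (Finset.notMem_erase z s), hbox _ _ _ (Finset.notMem_erase z s),
      marginal_inter_ne_zero h0 h1, mul_assoc]
  · have e1 : {η : Config | η z ≠ 0}
        = {η | η z ∈ Set.univ ∩ {k | k ≠ 0} ∧ ∀ i ∈ (∅ : Finset ℤ), η i ∈ (Set.univ : Set ℕ)} := by
      ext η; simp
    rw [Measure.restrict_apply_univ, Measure.smul_apply, Measure.map_apply hmeas MeasurableSet.univ,
      e1, hbox _ (fun _ => Set.univ) _ (Finset.notMem_empty z), marginal_inter_ne_zero h0 h1]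
    simp

/-- The change of variables behind the invariance and the reversibility of the equilibrium. -/
lemma integral_rateIn_mul {φ : ℝ} (h0 : 0 ≤ φ) (h1 : φ < 1) (Λ : Finset ℤ) (z : ℤ) (F : Obs) :
    ∫ η, rateIn φ Λ z η * F η ∂(productLaw unitRate φ)
      = φ * ∫ η, F (addIn Λ z η) ∂(productLaw unitRate φ) := by
  by_cases hz : z ∈ Λ
  · have hset : MeasurableSet {η : Config | η z ≠ 0} :=
      measurableSet_occupied z
    have e : ∀ η, rateIn φ Λ z η * F η = Set.indicator {η : Config | η z ≠ 0} (fun η => F η) η := by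
      intro η
      by_cases h : η z = 0 <;> simp [rateIn, hz, unitRate, h]
    simp_rw [e]
    rw [integral_indicator (measurableSet_occupied z), restrict_productLaw h0 h1 hz,
      integral_smul_measure,
      integral_map (continuous_addIn Λ z).measurable.aemeasurable
        F.continuous.measurable.aestronglyMeasurable, ENNReal.toReal_ofReal h0, smul_eq_mul]
  · simp [rateIn, addIn, hz, integral_const_mul]

/-! ### Reversibility and the Dirichlet form -/

/-- Integration of observables along a random configuration, weighted by a bounded variable. -/
lemma exists_weighted_expectation {Ω : Type*} {mΩ : MeasurableSpace Ω} (P : Measure Ω)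
    [IsProbabilityMeasure P] {X : Ω → Config} (hX : Measurable X) {G : Ω → ℝ} (hG : Measurable G)
    {K : ℝ} (hK : ∀ ω, |G ω| ≤ K) :
    ∃ m : Obs →L[ℝ] ℝ, (∀ f, m f = ∫ ω, G ω * f (X ω) ∂P) ∧ ∀ f, |m f| ≤ K * ‖f‖ := by
  have hb : ∀ (f : Obs) ω, ‖G ω * f (X ω)‖ ≤ K * ‖f‖ := fun f ω => by
    rw [norm_mul]
    exact mul_le_mul (hK ω) (f.norm_coe_le_norm _) (norm_nonneg _) ((abs_nonneg _).trans (hK ω))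
  have hi : ∀ f : Obs, Integrable (fun ω => G ω * f (X ω)) P := fun f =>
    Integrable.of_bound (hG.mul (f.continuous.measurable.comp hX)).aestronglyMeasurable _
      (ae_of_all _ (hb f))
  have hle : ∀ f : Obs, ‖∫ ω, G ω * f (X ω) ∂P‖ ≤ K * ‖f‖ := fun f => by
    simpa using norm_integral_le_of_norm_le_const (ae_of_all P (hb f))
  refine ⟨LinearMap.mkContinuous
    { toFun := fun f => ∫ ω, G ω * f (X ω) ∂P
      map_add' := fun f h => ?_
      map_smul' := fun a f => ?_ } K hle, fun f => rfl, hle⟩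
  · rw [← integral_add (hi f) (hi h)]
    exact integral_congr_ae (ae_of_all _ fun ω => by simp [mul_add])
  · rw [RingHom.id_apply, smul_eq_mul, ← integral_const_mul]
    exact integral_congr_ae (ae_of_all _ fun ω => by simp; ring)

lemma integrable_obs (μ : Measure Config) [IsProbabilityMeasure μ] (f : Obs) :
    Integrable (fun η => f η) μ := f.integrable μ

/-- Adding a particle, as a continuous map. -/
noncomputable def addMap (Λ : Finset ℤ) (x : ℤ) : C(Config, Config) :=
  ⟨addIn Λ x, continuous_addIn Λ x⟩

/-- The difference between an extra particle at `x + 1` and one at `x`. -/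
noncomputable def bondGradient (Λ : Finset ℤ) (x : ℤ) (f : Obs) : Obs :=
  f.compContinuous (addMap Λ (x + 1)) - f.compContinuous (addMap Λ x)

lemma bondGradient_apply (Λ : Finset ℤ) (x : ℤ) (f : Obs) (η : Config) :
    bondGradient Λ x f η = f (addIn Λ (x + 1) η) - f (addIn Λ x η) := rfl

/-- The Dirichlet form of the finite volume with reservoirs. -/
lemma integral_mul_reservoirGen {φ : ℝ} (h0 : 0 ≤ φ) (h1 : φ < 1) (c : ℤ → ℝ) (R : ℕ)
    (f h : Obs) :
    ∫ η, f η * reservoirGen c φ R h η ∂(productLaw unitRate φ)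
      = -∑ x ∈ bonds R, φ * c x * ∫ η, bondGradient (box R) x f η * bondGradient (box R) x h η
          ∂(productLaw unitRate φ) := by
  have := isProbabilityMeasure_productLaw h0 h1
  set ν := productLaw unitRate φ with hν
  -- one direction of the jumps across a bond
  have hone : ∀ x y, ∫ η, rateIn φ (box R) x η *
      (f η * (h (addIn (box R) y (removeIn (box R) x η)) - h η)) ∂ν
      = φ * ∫ η, f (addIn (box R) x η) * (h (addIn (box R) y η) - h (addIn (box R) x η)) ∂ν := by
    intro x y
    have := integral_rateIn_mul h0 h1 (box R) x (f * (h.compContinuous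
      ⟨fun η => addIn (box R) y (removeIn (box R) x η),
        (continuous_addIn (box R) y).comp (continuous_removeIn (box R) x)⟩ - h))
    simp only [BoundedContinuousFunction.coe_mul, Pi.mul_apply, BoundedContinuousFunction.coe_sub,
      Pi.sub_apply, BoundedContinuousFunction.compContinuous_apply, ContinuousMap.coe_mk,
      removeIn_addIn_self] at this
    exact this
  have hint : ∀ x y, Integrable (fun η => rateIn φ (box R) x η *
      (f η * (h (addIn (box R) y (removeIn (box R) x η)) - h η))) ν := fun x y =>
    integrable_obs ν (rateObs φ (box R) x * (f * (h.compContinuous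
      ⟨fun η => addIn (box R) y (removeIn (box R) x η),
        (continuous_addIn (box R) y).comp (continuous_removeIn (box R) x)⟩ - h)))
  have hint2 : ∀ x y, Integrable (fun η => f (addIn (box R) x η) *
      (h (addIn (box R) y η) - h (addIn (box R) x η))) ν := fun x y =>
    integrable_obs ν (f.compContinuous (addMap (box R) x) *
      (h.compContinuous (addMap (box R) y) - h.compContinuous (addMap (box R) x)))
  have hint3 : ∀ x, Integrable (fun η => rateIn φ (box R) x η *
      (f η * (h (addIn (box R) (x + 1) (removeIn (box R) x η)) - h η)) +
      rateIn φ (box R) (x + 1) η *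
      (f η * (h (addIn (box R) x (removeIn (box R) (x + 1) η)) - h η))) ν := fun x =>
    (hint x (x + 1)).add (hint (x + 1) x)
  have e1 : ∀ η, f η * reservoirGen c φ R h η = ∑ x ∈ bonds R, (c x * (rateIn φ (box R) x η *
      (f η * (h (addIn (box R) (x + 1) (removeIn (box R) x η)) - h η)) +
      rateIn φ (box R) (x + 1) η *
      (f η * (h (addIn (box R) x (removeIn (box R) (x + 1) η)) - h η)))) := by
    intro η
    rw [reservoirGen_apply, Finset.mul_sum]
    exact Finset.sum_congr rfl fun x _ => by ring
  simp_rw [e1]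
  rw [integral_finsetSum _ fun x _ => Integrable.const_mul (hint3 x) (c x),
    ← Finset.sum_neg_distrib]
  refine Finset.sum_congr rfl fun x _ => ?_
  rw [integral_const_mul, integral_add (hint x (x + 1)) (hint (x + 1) x), hone, hone, ← mul_add,
    ← integral_add (hint2 x (x + 1)) (hint2 (x + 1) x)]
  have e2 : ∫ η, (f (addIn (box R) x η) * (h (addIn (box R) (x + 1) η) - h (addIn (box R) x η)) +
      f (addIn (box R) (x + 1) η) * (h (addIn (box R) x η) - h (addIn (box R) (x + 1) η))) ∂ν
      = -∫ η, bondGradient (box R) x f η * bondGradient (box R) x h η ∂ν := by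
    rw [← integral_neg]
    exact integral_congr_ae (ae_of_all _ fun η => by
      simp only [bondGradient_apply]; ring)
  rw [e2]
  ring

/-- The current observable `∑_{x ∈ A} a x (g(η(x)) - g(η(x+1)))`. The rate at `x` is written as
`rateObs 0 {x} x`, where neither the fugacity nor the rest of the volume matters. -/
noncomputable def current (A : Finset ℤ) (a : ℤ → ℝ) : Obs :=
  ∑ x ∈ A, a x • (rateObs 0 {x} x - rateObs 0 {x + 1} (x + 1))

lemma current_apply (A : Finset ℤ) (a : ℤ → ℝ) (η : Config) :
    current A a η = ∑ x ∈ A, a x * (unitRate (η x) - unitRate (η (x + 1))) := by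
  have h : ∀ x, rateObs 0 {x} x η = unitRate (η x) := fun x => by
    change rateIn 0 {x} x η = _
    simp [rateIn]
  simp [current, BoundedContinuousFunction.sum_apply, h]

lemma exists_dependsOn_current (A : Finset ℤ) (a : ℤ → ℝ) :
    ∃ M : ℕ, (∀ x ∈ A, x ∈ box M ∧ x + 1 ∈ box M) ∧ DependsOn (current A a) (box M : Set ℤ) := by
  have hM : ∃ M : ℕ, ∀ x ∈ A, x ∈ box M ∧ x + 1 ∈ box M := by
    refine ⟨∑ x ∈ A, (x.natAbs + 1), fun x hx => ?_⟩
    have := Finset.single_le_sum (f := fun x : ℤ => x.natAbs + 1) (fun _ _ => Nat.zero_le _) hx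
    rw [mem_box, mem_box]
    omega
  obtain ⟨M, hM⟩ := hM
  refine ⟨M, hM, fun η ζ h => ?_⟩
  rw [current_apply, current_apply]
  refine Finset.sum_congr rfl fun x hx => ?_
  rw [h x (hM x hx).1, h (x + 1) (hM x hx).2]

/-- The variational norm of the current is at most `φ ∑ₓ a(x)² / c(x)`. -/
lemma current_variational {φ : ℝ} (h0 : 0 ≤ φ) (h1 : φ < 1) {c : ℤ → ℝ} (hc : ∀ x, 0 < c x)
    {R : ℕ} {A : Finset ℤ} (hA : ∀ x ∈ A, x ∈ box R ∧ x + 1 ∈ box R) (a : ℤ → ℝ) (f : Obs) :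
    2 * ∫ η, current A a η * f η ∂(productLaw unitRate φ)
      + ∫ η, f η * reservoirGen c φ R f η ∂(productLaw unitRate φ)
      ≤ φ * ∑ x ∈ A, a x ^ 2 * (c x)⁻¹ := by
  have := isProbabilityMeasure_productLaw h0 h1
  set ν := productLaw unitRate φ with hν
  have hint : ∀ x, Integrable (fun η => f (addIn (box R) x η)) ν := fun x =>
    integrable_obs ν (f.compContinuous (addMap (box R) x))
  have hsite : ∀ x ∈ box R, ∫ η, unitRate (η x) * f η ∂ν
      = φ * ∫ η, f (addIn (box R) x η) ∂ν := by
    intro x hx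
    rw [← integral_rateIn_mul h0 h1]
    exact integral_congr_ae (ae_of_all _ fun η => by simp [rateIn, hx])
  have hintr : ∀ x, Integrable (fun η : Config => unitRate (η x) * f η) ν := by
    intro x
    refine (integrable_obs ν (rateObs 0 {x} x * f)).congr (ae_of_all _ fun η => ?_)
    change rateIn 0 {x} x η * f η = _
    simp [rateIn]
  have hcur : ∫ η, current A a η * f η ∂ν
      = -∑ x ∈ A, φ * a x * ∫ η, bondGradient (box R) x f η ∂ν := by
    have e1 : ∀ η, current A a η * f η
        = ∑ x ∈ A, a x * (unitRate (η x) * f η - unitRate (η (x + 1)) * f η) := by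
      intro η
      rw [current_apply, Finset.sum_mul]
      exact Finset.sum_congr rfl fun x _ => by ring
    simp_rw [e1]
    have hint' : ∀ x, Integrable (fun η : Config =>
        unitRate (η x) * f η - unitRate (η (x + 1)) * f η) ν := fun x =>
      (hintr x).sub (hintr (x + 1))
    rw [integral_finsetSum _ fun x _ => (hint' x).const_mul (a x),
      ← Finset.sum_neg_distrib]
    refine Finset.sum_congr rfl fun x hx => ?_
    rw [integral_const_mul, integral_sub (hintr x) (hintr (x + 1)), hsite x (hA x hx).1,
      hsite (x + 1) (hA x hx).2]
    simp_rw [bondGradient_apply]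
    rw [integral_sub (hint (x + 1)) (hint x)]
    ring
  rw [hcur, integral_mul_reservoirGen h0 h1]
  have hsub : A ⊆ bonds R := fun x hx => by
    have := (hA x hx).1
    rw [mem_box] at this
    rw [mem_bonds]
    omega
  have hnn : ∀ x, 0 ≤ φ * c x *
      ∫ η, bondGradient (box R) x f η * bondGradient (box R) x f η ∂ν := fun x =>
    mul_nonneg (mul_nonneg h0 (hc x).le) (integral_nonneg fun η => mul_self_nonneg _)
  have hle := Finset.sum_le_sum_of_subset_of_nonneg hsub fun x _ _ => hnn x
  have hterm : ∀ x ∈ A, -(2 * (φ * a x * ∫ η, bondGradient (box R) x f η ∂ν))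
      - φ * c x * ∫ η, bondGradient (box R) x f η * bondGradient (box R) x f η ∂ν
      ≤ φ * (a x ^ 2 * (c x)⁻¹) := by
    intro x _
    set g := bondGradient (box R) x f with hg
    have i1 : Integrable (fun η => g η) ν := integrable_obs ν g
    have i2 : Integrable (fun η => g η * g η) ν := integrable_obs ν (g * g)
    have hmono : ∫ η, (-(2 * a x) * g η - c x * (g η * g η)) ∂ν ≤ ∫ _, a x ^ 2 * (c x)⁻¹ ∂ν := by
      refine integral_mono ((i1.const_mul _).sub (i2.const_mul _)) (integrable_const _) fun η => ?_
      -- complete the square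
      have hsq : a x ^ 2 * (c x)⁻¹ - (-(2 * a x) * g η - c x * (g η * g η))
          = c x * (g η + a x * (c x)⁻¹) ^ 2 := by
        have := (hc x).ne'
        field_simp
        ring
      have := mul_nonneg (hc x).le (sq_nonneg (g η + a x * (c x)⁻¹))
      simp only
      linarith
    rw [integral_sub (i1.const_mul _) (i2.const_mul _), integral_const_mul, integral_const_mul,
      integral_const, probReal_univ, one_smul] at hmono
    have := mul_le_mul_of_nonneg_left hmono h0
    linarith
  have hfin := Finset.sum_le_sum hterm
  rw [Finset.sum_sub_distrib, Finset.sum_neg_distrib, ← Finset.mul_sum, ← Finset.mul_sum] at hfin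
  linarith

/-- In equilibrium, the autocorrelation of the current, integrated over time, is at most
`φ ∑ₓ a(x)² / c(x)`, uniformly in the volume and in time. -/
lemma integral_autocorrelation_current_le {φ : ℝ} (h0 : 0 ≤ φ) (h1 : φ < 1) {c : ℤ → ℝ}
    (hc : ∀ x, 0 < c x) {R : ℕ} {A : Finset ℤ} (hA : ∀ x ∈ A, x ∈ box R ∧ x + 1 ∈ box R)
    (a : ℤ → ℝ) {s : ℝ} (hs : 0 ≤ s) :
    ∫ τ in (0 : ℝ)..s, ∫ η, current A a η * reservoirSemigroup c φ R τ (current A a) η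
      ∂(productLaw unitRate φ) ≤ φ * ∑ x ∈ A, a x ^ 2 * (c x)⁻¹ := by
  have := isProbabilityMeasure_productLaw h0 h1
  obtain ⟨I, hI, -⟩ := exists_weighted_expectation (productLaw unitRate φ) measurable_id
    (measurable_const (a := (1 : ℝ))) (K := 1) (fun _ => by simp)
  simp only [id, one_mul] at hI
  set B : Obs →L[ℝ] Obs →L[ℝ] ℝ :=
    (ContinuousLinearMap.compL ℝ Obs Obs ℝ I).comp (ContinuousLinearMap.mul ℝ Obs) with hBdef
  have hB : ∀ f h, B f h = ∫ η, f η * h η ∂(productLaw unitRate φ) := fun f h => by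
    have : B f h = I (f * h) := rfl
    rw [this, hI]
    rfl
  have hcomm : ∀ f h, B f h = B h f := fun f h => by
    rw [hB, hB]
    exact integral_congr_ae (ae_of_all _ fun η => mul_comm _ _)
  have hsymm : ∀ f h, B (reservoirGen c φ R f) h = B f (reservoirGen c φ R h) := fun f h => by
    rw [hcomm, hB, hB, integral_mul_reservoirGen h0 h1, integral_mul_reservoirGen h0 h1]
    congr 1
    refine Finset.sum_congr rfl fun x _ => ?_
    congr 1
    exact integral_congr_ae (ae_of_all _ fun η => mul_comm _ _)
  have := integral_autocorrelation_le B hcomm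
    (fun f => by rw [hB]; exact integral_nonneg fun η => mul_self_nonneg _) hsymm
    (V := current A a) (K := φ * ∑ x ∈ A, a x ^ 2 * (c x)⁻¹)
    (fun f => by rw [hB, hB]; exact current_variational h0 h1 hc hA a f) hs
  simp_rw [hB] at this
  exact this

/-- The equilibrium is invariant under the semigroup of the finite volume with reservoirs. -/
lemma integral_reservoirSemigroup {φ : ℝ} (h0 : 0 ≤ φ) (h1 : φ < 1) (c : ℤ → ℝ) (R : ℕ) (s : ℝ)
    (f : Obs) :
    ∫ η, reservoirSemigroup c φ R s f η ∂(productLaw unitRate φ)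
      = ∫ η, f η ∂(productLaw unitRate φ) := by
  have := isProbabilityMeasure_productLaw h0 h1
  obtain ⟨I, hI, -⟩ := exists_weighted_expectation (productLaw unitRate φ) measurable_id
    (measurable_const (a := (1 : ℝ))) (K := 1) (fun _ => by simp)
  simp only [id, one_mul] at hI
  have hL : ∀ h, I (reservoirGen c φ R h) = 0 := fun h => by
    rw [hI]
    have := integral_mul_reservoirGen h0 h1 c R 1 h
    simpa [bondGradient] using this
  have hd : ∀ s, HasDerivAt (fun s => I (reservoirSemigroup c φ R s f)) 0 s := fun s => by
    have := I.hasFDerivAt.comp_hasDerivAt s (hasDerivAt_expFlow (reservoirGen c φ R) f s)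
    rw [hL] at this
    exact this
  have := is_const_of_deriv_eq_zero (fun s => (hd s).differentiableAt) (fun s => (hd s).deriv) s 0
  rw [← hI, ← hI, this, reservoirSemigroup, expFlow_zero]
  rfl

/-! ### Time integrals along a right-continuous process -/

section Path

variable {Ω : Type*} {mΩ : MeasurableSpace Ω} {η : ℝ≥0 → Ω → Config}

/-- Right-continuity makes the process jointly measurable: it is the limit of its values at the next
point of the grid `ℕ / (k + 1)`. -/
lemma measurable_obs_process (hm : ∀ t, Measurable (η t))
    (hr : ∀ ω t, ContinuousWithinAt (fun s => η s ω) (Set.Ici t) t) (f : Obs) :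
    Measurable fun p : ℝ × Ω => f (η p.1.toNNReal p.2) := by
  have hmeas : ∀ k : ℕ, Measurable fun p : ℝ × Ω =>
      f (η ((⌊p.1.toNNReal * (k + 1)⌋₊ + 1 : ℝ≥0) / (k + 1)) p.2) := by
    intro k
    have h1 : Measurable fun q : ℕ × Ω => f (η ((q.1 + 1 : ℝ≥0) / (k + 1)) q.2) :=
      measurable_from_prod_countable_right fun j =>
        f.continuous.measurable.comp (hm ((j + 1 : ℝ≥0) / (k + 1)))
    have h2 : Measurable fun p : ℝ × Ω => p.1.toNNReal * ((k : ℝ≥0) + 1) :=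
      (measurable_real_toNNReal.comp measurable_fst).mul_const _
    have h3 := h1.comp (h2.nat_floor.prodMk measurable_snd)
    simp only [Function.comp_def] at h3
    exact h3
  refine measurable_of_tendsto_metrizable hmeas (tendsto_pi_nhds.2 fun p => ?_)
  refine (f.continuous.tendsto _).comp ?_
  refine (hr p.2 p.1.toNNReal).tendsto.comp (tendsto_nhdsWithin_iff.2 ⟨?_, ?_⟩)
  · set t := p.1.toNNReal
    have hlim : Tendsto (fun k : ℕ => t + 1 / ((k : ℝ≥0) + 1)) atTop (𝓝 t) := by
      have := (tendsto_one_div_add_atTop_nhds_zero_nat (𝕜 := ℝ≥0)).const_add t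
      rwa [add_zero] at this
    refine tendsto_of_tendsto_of_tendsto_of_le_of_le tendsto_const_nhds hlim (fun k => ?_)
      fun k => ?_
    · rw [le_div_iff₀ (by positivity)]
      exact (Nat.lt_floor_add_one _).le
    · have hk : (0 : ℝ≥0) < k + 1 := by positivity
      simp only
      rw [add_div]
      gcongr
      rw [div_le_iff₀ hk]
      exact Nat.floor_le (by positivity)
  · refine Eventually.of_forall fun k => ?_
    rw [Set.mem_Ici, le_div_iff₀ (by positivity)]
    exact (Nat.lt_floor_add_one _).le

variable (hm : ∀ t, Measurable (η t))
  (hr : ∀ ω t, ContinuousWithinAt (fun s => η s ω) (Set.Ici t) t)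

include hm hr

lemma intervalIntegrable_obs_path (f : Obs) (ω : Ω) (a b : ℝ) :
    IntervalIntegrable (fun s => f (η s.toNNReal ω)) volume a b := by
  refine (intervalIntegrable_const (c := ‖f‖)).mono_fun ?_ (ae_of_all _ fun s => ?_)
  · exact ((measurable_obs_process hm hr f).comp measurable_prodMk_right).aestronglyMeasurable
  · rw [norm_norm]
    exact f.norm_coe_le_norm _

lemma measurable_integral_path (f : Obs) (a b : ℝ) :
    Measurable fun ω => ∫ s in a..b, f (η s.toNNReal ω) := by
  have h : ∀ c d : ℝ, Measurable fun ω => ∫ s in Set.Ioc c d, f (η s.toNNReal ω) := fun c d =>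
    (((measurable_obs_process hm hr f).comp measurable_swap).stronglyMeasurable.integral_prod_right'
      (ν := volume.restrict (Set.Ioc c d))).measurable
  exact (h a b).sub (h b a)

omit hm hr in
lemma abs_integral_path_le (f : Obs) (ω : Ω) {a b : ℝ} (hab : a ≤ b) :
    |∫ s in a..b, f (η s.toNNReal ω)| ≤ ‖f‖ * (b - a) := by
  have := intervalIntegral.norm_integral_le_of_norm_le_const (a := a) (b := b)
    (f := fun s => f (η s.toNNReal ω)) (C := ‖f‖) fun s _ => f.norm_coe_le_norm _
  rwa [abs_of_nonneg (sub_nonneg.2 hab)] at this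

variable (P : Measure Ω) [IsProbabilityMeasure P]

lemma intervalIntegrable_expectation {G : Ω → ℝ} (hG : Measurable G) {K : ℝ}
    (hK : ∀ ω, |G ω| ≤ K) (f : Obs) (a b : ℝ) :
    IntervalIntegrable (fun s => ∫ ω, G ω * f (η s.toNNReal ω) ∂P) volume a b := by
  refine (intervalIntegrable_const (c := K * ‖f‖)).mono_fun ?_ (ae_of_all _ fun s => ?_)
  · exact (((hG.comp measurable_snd).mul
      (measurable_obs_process hm hr f)).stronglyMeasurable.integral_prod_right'
      (ν := P)).aestronglyMeasurable
  · have hb : ∀ ω, ‖G ω * f (η s.toNNReal ω)‖ ≤ K * ‖f‖ := fun ω => by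
      rw [norm_mul]
      exact mul_le_mul (hK ω) (f.norm_coe_le_norm _) (norm_nonneg _) ((abs_nonneg _).trans (hK ω))
    have := norm_integral_le_of_norm_le_const (ae_of_all P hb)
    rw [probReal_univ, mul_one] at this
    exact this.trans (le_abs_self _)

lemma integral_mul_integral_path {G : Ω → ℝ} (hG : Measurable G) {K : ℝ}
    (hK : ∀ ω, |G ω| ≤ K) (f : Obs) {a b : ℝ} (hab : a ≤ b) :
    ∫ ω, G ω * (∫ s in a..b, f (η s.toNNReal ω)) ∂P
      = ∫ s in a..b, ∫ ω, G ω * f (η s.toNNReal ω) ∂P := by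
  simp_rw [← intervalIntegral.integral_const_mul, intervalIntegral.integral_of_le hab]
  refine integral_integral_swap (Integrable.of_bound (C := K * ‖f‖) ?_ (ae_of_all _ ?_))
  · exact ((hG.comp measurable_fst).mul
      ((measurable_obs_process hm hr f).comp measurable_swap)).aestronglyMeasurable
  · rintro ⟨ω, s⟩
    rw [Function.uncurry_apply_pair, norm_mul]
    exact mul_le_mul (hK ω) (f.norm_coe_le_norm _) (norm_nonneg _) ((abs_nonneg _).trans (hK ω))

end Path

/-! ### Duality with the finite volume -/

/-- Product rule for a family of functionals applied to a curve. -/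
lemma hasDerivWithinAt_functional {E : Type*} [NormedAddCommGroup E] [NormedSpace ℝ E]
    {m : ℝ → E →L[ℝ] ℝ} {K : ℝ} (hm : ∀ s f, |m s f| ≤ K * ‖f‖) {U : ℝ → E} {U' : E} {s d : ℝ}
    {A : Set ℝ} (hU : HasDerivAt U U' s) (hd : HasDerivWithinAt (fun r => m r (U s)) d A s)
    (hc : ContinuousWithinAt (fun r => m r U') A s) :
    HasDerivWithinAt (fun r => m r (U r)) (d + m s U') A s := by
  rw [hasDerivWithinAt_iff_tendsto_slope] at hd ⊢
  have hU' : Tendsto (slope U s) (𝓝[A \ {s}] s) (𝓝 U') :=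
    (hasDerivAt_iff_tendsto_slope.1 hU).mono_left (nhdsWithin_mono _ fun x hx => hx.2)
  have h1 : Tendsto (fun r => m r (slope U s r - U')) (𝓝[A \ {s}] s) (𝓝 0) := by
    refine squeeze_zero_norm (fun r => hm r _) ?_
    have := (hU'.sub_const U').norm.const_mul K
    simpa using this
  have h2 : Tendsto (fun r => m r U') (𝓝[A \ {s}] s) (𝓝 (m s U')) :=
    hc.tendsto.mono_left (nhdsWithin_mono _ Set.sdiff_subset)
  have h3 := (hd.add h1).add h2
  rw [add_zero] at h3
  refine h3.congr fun r => ?_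
  simp only [slope_def_module, map_sub, map_smul, smul_eq_mul]
  ring

section Dynamics

variable {Ω : Type*} {mΩ : MeasurableSpace Ω} {P : Measure Ω}
  {𝓕 : Filtration ℝ≥0 mΩ} {c : ℤ → ℝ} {μ₀ : Measure Config} {η : ℝ≥0 → Ω → Config}

lemma IsZeroRangeProcess.measurable (hη : IsZeroRangeProcess (bondRate c) unitRate μ₀ 𝓕 P η)
    (t : ℝ≥0) : Measurable (η t) := (hη.adapted t).mono (𝓕.le t) le_rfl

variable [IsProbabilityMeasure P]

/-- The martingale problem, tested against a bounded variable of the past. -/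
lemma IsZeroRangeProcess.expectation_sub
    (hη : IsZeroRangeProcess (bondRate c) unitRate μ₀ 𝓕 P η) (φ : ℝ) {R : ℕ} {f : Obs}
    (hf : DependsOn f (box R : Set ℤ)) {a b : ℝ} (ha : 0 ≤ a) (hab : a ≤ b) {G : Ω → ℝ}
    (hG : Measurable[𝓕 a.toNNReal] G) {K : ℝ} (hK : ∀ ω, |G ω| ≤ K) :
    ∫ ω, G ω * f (η b.toNNReal ω) ∂P - ∫ ω, G ω * f (η a.toNNReal ω) ∂P
      = ∫ s in a..b, ∫ ω, G ω * reservoirGen c φ (R + 1) f (η s.toNNReal ω) ∂P := by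
  have hm := hη.measurable
  have hr := hη.right_continuous
  have hG' : Measurable G := hG.mono (𝓕.le _) le_rfl
  set h := reservoirGen c φ (R + 1) f with hh
  have hmart := hη.martingale f (box R) hf ⟨‖f‖, fun ζ => f.norm_coe_le_norm ζ⟩
  simp_rw [generator_bondRate c φ hf] at hmart
  have hle : a.toNNReal ≤ b.toNNReal := Real.toNNReal_le_toNNReal hab
  have hint := hmart.integrable
  have hGint : ∀ t, Integrable (fun ω => G ω * (f (η t ω)
      - ∫ s in (0 : ℝ)..t, h (η s.toNNReal ω))) P := fun t =>
    (hint t).bdd_mul hG'.aestronglyMeasurable (ae_of_all _ hK)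
  have hce := condExp_stronglyMeasurable_mul_of_bound (𝓕.le a.toNNReal) hG.stronglyMeasurable
    (hint b.toNNReal) K (ae_of_all _ hK)
  have heq : ∫ ω, G ω * (f (η b.toNNReal ω) - ∫ s in (0 : ℝ)..b.toNNReal, h (η s.toNNReal ω)) ∂P
      = ∫ ω, G ω * (f (η a.toNNReal ω) - ∫ s in (0 : ℝ)..a.toNNReal, h (η s.toNNReal ω)) ∂P := by
    have e1 := integral_condExp (𝓕.le a.toNNReal) (μ := P) (f := G * fun ω =>
      f (η b.toNNReal ω) - ∫ s in (0 : ℝ)..b.toNNReal, h (η s.toNNReal ω))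
    refine e1.symm.trans (integral_congr_ae ?_)
    filter_upwards [hce, hmart.2 _ _ hle] with ω h1 h2
    rw [h1, Pi.mul_apply, h2]
  have hfint : ∀ t, Integrable (fun ω => G ω * f (η t ω)) P := fun t => by
    refine Integrable.of_bound (C := K * ‖f‖)
      (hG'.mul (f.continuous.measurable.comp (hm t))).aestronglyMeasurable (ae_of_all _ fun ω => ?_)
    rw [norm_mul]
    exact mul_le_mul (hK ω) (f.norm_coe_le_norm _) (norm_nonneg _) ((abs_nonneg _).trans (hK ω))
  rw [Real.coe_toNNReal _ ha, Real.coe_toNNReal _ (ha.trans hab)] at heq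
  have hGa := hGint a.toNNReal
  have hGb := hGint b.toNNReal
  rw [Real.coe_toNNReal _ ha] at hGa
  rw [Real.coe_toNNReal _ (ha.trans hab)] at hGb
  rw [← integral_mul_integral_path hm hr P hG' hK h hab, ← integral_sub (hfint _) (hfint _)]
  have e2 : ∀ ω, G ω * f (η b.toNNReal ω) - G ω * f (η a.toNNReal ω)
      = (G ω * (f (η b.toNNReal ω) - ∫ s in (0 : ℝ)..b, h (η s.toNNReal ω))
        - G ω * (f (η a.toNNReal ω) - ∫ s in (0 : ℝ)..a, h (η s.toNNReal ω)))
        + G ω * ∫ s in a..b, h (η s.toNNReal ω) := fun ω => by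
    rw [← intervalIntegral.integral_add_adjacent_intervals
      (intervalIntegrable_obs_path hm hr h ω 0 a) (intervalIntegrable_obs_path hm hr h ω a b)]
    ring
  simp_rw [e2]
  have hI : Integrable (fun ω => G ω * ∫ s in a..b, h (η s.toNNReal ω)) P := by
    refine Integrable.of_bound (C := K * (‖h‖ * (b - a)))
      (hG'.mul (measurable_integral_path hm hr h a b)).aestronglyMeasurable
      (ae_of_all _ fun ω => ?_)
    rw [norm_mul]
    exact mul_le_mul (hK ω) (abs_integral_path_le h ω hab) (norm_nonneg _)
      ((abs_nonneg _).trans (hK ω))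
  have hGab : Integrable (fun ω =>
      G ω * (f (η b.toNNReal ω) - ∫ s in (0 : ℝ)..b, h (η s.toNNReal ω))
        - G ω * (f (η a.toNNReal ω) - ∫ s in (0 : ℝ)..a, h (η s.toNNReal ω))) P := hGb.sub hGa
  rw [integral_add hGab hI, integral_sub hGb hGa, heq, sub_self, zero_add]

/-- Up to an error that vanishes as `R → ∞`, the process evolves local observables, conditionally on
the past, by the semigroup of `box R`: differentiate `s ↦ E[G (e^{(t - s) L_R} f)(η_s)]`. -/
lemma IsZeroRangeProcess.abs_expectation_sub_le {S : ℤ → ℝ} (hS : StrictMono S)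
    (hη : IsZeroRangeProcess (bondRate (conductance S)) unitRate μ₀ 𝓕 P η) {φ : ℝ} (h0 : 0 ≤ φ)
    (h1 : φ ≤ 1) {M R : ℕ} (hMR : M ≤ R) {f : Obs} (hf : DependsOn f (box M : Set ℤ)) {r t : ℝ}
    (hr0 : 0 ≤ r) (hrt : r ≤ t) {G : Ω → ℝ} (hG : Measurable[𝓕 r.toNNReal] G) {K : ℝ}
    (hK : ∀ ω, |G ω| ≤ K) :
    |∫ ω, G ω * f (η t.toNNReal ω) ∂P
        - ∫ ω, G ω * reservoirSemigroup (conductance S) φ R (t - r) f (η r.toNNReal ω) ∂P|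
      ≤ K * (2 * ‖f‖ * leak S M R) * (t - r) := by
  have hm := hη.measurable
  have hrc := hη.right_continuous
  have hG' : Measurable G := hG.mono (𝓕.le _) le_rfl
  obtain ⟨ω₀⟩ : Nonempty Ω := by
    by_contra h
    rw [not_nonempty_iff] at h
    have := measure_univ (μ := P)
    simp [Set.univ_eq_empty_iff.2 h] at this
  have hK0 : 0 ≤ K := (abs_nonneg _).trans (hK ω₀)
  have hfR : DependsOn f (box R : Set ℤ) := fun η ζ h => hf fun i hi => h i (box_subset hMR hi)
  set c := conductance S with hc
  choose m hmv hmb using fun s : ℝ => exists_weighted_expectation P (hm s.toNNReal) hG' hK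
  -- the functionals are differentiable in time along local observables
  have hdiff : ∀ (Q : ℕ) (v : Obs), DependsOn v (box Q : Set ℤ) → ∀ a b, r ≤ a → a ≤ b →
      m b v - m a v = ∫ s in a..b, m s (reservoirGen c φ (Q + 1) v) := by
    intro Q v hv a b hra hab
    simp_rw [hmv]
    exact hη.expectation_sub φ hv (hr0.trans hra) hab
      (hG.mono (𝓕.mono (Real.toNNReal_le_toNNReal hra)) le_rfl) hK
  have hcont : ∀ (Q : ℕ) (v : Obs), DependsOn v (box Q : Set ℤ) →
      ContinuousOn (fun s => m s v) (Set.Ici r) := by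
    intro Q v hv
    have hlip : ∀ a b, r ≤ a → a ≤ b →
        |m b v - m a v| ≤ K * ‖reservoirGen c φ (Q + 1) v‖ * (b - a) := by
      intro a b hra hab
      rw [hdiff Q v hv a b hra hab]
      have := intervalIntegral.norm_integral_le_of_norm_le_const (a := a) (b := b)
        (f := fun s => m s (reservoirGen c φ (Q + 1) v)) fun s _ => hmb s _
      rwa [abs_of_nonneg (sub_nonneg.2 hab)] at this
    refine (LipschitzOnWith.of_dist_le_mul (K := (K * ‖reservoirGen c φ (Q + 1) v‖).toNNReal)
      fun a ha b hb => ?_).continuousOn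
    rw [Real.coe_toNNReal _ (by positivity), Real.dist_eq, Real.dist_eq]
    rcases le_total a b with hab | hab
    · rw [abs_sub_comm, abs_sub_comm a b, abs_of_nonneg (sub_nonneg.2 hab)]
      exact hlip a b ha hab
    · rw [abs_of_nonneg (sub_nonneg.2 hab)]
      exact hlip b a hb hab
  have hderiv : ∀ (Q : ℕ) (v : Obs), DependsOn v (box Q : Set ℤ) → ∀ s, r ≤ s →
      HasDerivWithinAt (fun s => m s v) (m s (reservoirGen c φ (Q + 1) v)) (Set.Ici r) s := by
    intro Q v hv s hs
    set w := reservoirGen c φ (Q + 1) v with hw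
    have hvQ : DependsOn v (box (Q + 1) : Set ℤ) := fun η ζ h =>
      hv fun i hi => h i (box_subset (Nat.le_succ Q) hi)
    have hcw := hcont (Q + 1) w (dependsOn_reservoirGen hvQ)
    have hcw' : Continuous fun s => m (max r s) w :=
      hcw.comp_continuous (by fun_prop) fun s => le_max_left r s
    have hd := (hcw'.integral_hasStrictDerivAt r s).hasDerivAt.hasDerivWithinAt (s := Set.Ici r)
    have heq : ∀ s ∈ Set.Ici r, m s v = m r v + ∫ u in r..s, m (max r u) w := by
      intro s hs
      have h2 : ∫ u in r..s, m (max r u) w = ∫ u in r..s, m u w :=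
        intervalIntegral.integral_congr fun u hu => by
          rw [Set.uIcc_of_le hs] at hu
          simp only [max_eq_right hu.1]
      rw [h2, ← hdiff Q v hv r s le_rfl hs]
      ring
    rw [max_eq_right hs] at hd
    exact (hd.const_add (m r v)).congr heq (heq s hs)
  -- the mean value inequality
  set U : ℝ → Obs := fun s => reservoirSemigroup c φ R (t - s) f with hU
  have hUloc : ∀ s, s ≤ t → DependsOn (U s) (box R : Set ℤ) := fun s hs =>
    dependsOn_reservoirSemigroup hfR (sub_nonneg.2 hs)
  have hUd : ∀ s, HasDerivAt U (-reservoirGen c φ R (U s)) s := by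
    intro s
    have h2 : HasDerivAt (fun s => t - s) (-1) s := by
      simpa using (hasDerivAt_id s).const_sub t
    have := (hasDerivAt_expFlow (reservoirGen c φ R) f (t - s)).scomp s h2
    rw [neg_one_smul] at this
    exact this
  have hΦ : ∀ s, r ≤ s → s ≤ t → HasDerivWithinAt (fun s => m s (U s))
      (m s (reservoirGen c φ (R + 1) (U s)) + m s (-reservoirGen c φ R (U s))) (Set.Ici r) s := by
    intro s hrs hst
    refine hasDerivWithinAt_functional hmb (hUd s) (hderiv R (U s) (hUloc s hst) s hrs) ?_
    simp_rw [map_neg]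
    exact (hcont R _ (dependsOn_reservoirGen (hUloc s hst)) s hrs).neg
  have hmv' := norm_image_sub_le_of_norm_deriv_right_le_segment
    (f := fun s => m s (U s)) (a := r) (b := t) (C := K * (2 * ‖f‖ * leak S M R))
    (fun s hs => ((hΦ s hs.1 hs.2).mono Set.Icc_subset_Ici_self).continuousWithinAt)
    (fun s hs => (hΦ s hs.1 hs.2.le).mono (Set.Ici_subset_Ici.2 hs.1))
    (fun s hs => by
      rw [← map_add, ← sub_eq_add_neg]
      refine (hmb s _).trans (mul_le_mul_of_nonneg_left ?_ hK0)
      have key : ∀ ζ, |reservoirGen c φ (R + 1) (U s) ζ - reservoirGen c φ R (U s) ζ|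
          ≤ 2 * ‖f‖ * leak S M R := fun ζ =>
        abs_generator_sub_reservoirGen_le hS h0 h1 hMR hf (sub_nonneg.2 hs.2.le) ζ
      exact (BoundedContinuousFunction.norm_le
        ((abs_nonneg _).trans (key (fun _ => 0)))).2 key) t ⟨hrt, le_rfl⟩
  have hUt : U t = f := by
    simp only [hU, sub_self, reservoirSemigroup, expFlow_zero]
    rfl
  simp only [hUt, hmv, Real.norm_eq_abs] at hmv'
  exact hmv'

variable {S : ℤ → ℝ} {φ : ℝ}

/-- A solution of the martingale problem that starts in equilibrium is stationary. -/
lemma IsZeroRangeProcess.expectation_eq (hS : StrictMono S) (hTop : Tendsto S atTop atTop)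
    (hBot : Tendsto S atBot atBot) (h0 : 0 ≤ φ) (h1 : φ < 1)
    (hη : IsZeroRangeProcess (bondRate (conductance S)) unitRate (productLaw unitRate φ) 𝓕 P η)
    {M : ℕ} {f : Obs} (hf : DependsOn f (box M : Set ℤ)) {t : ℝ} (ht : 0 ≤ t) :
    ∫ ω, f (η t.toNNReal ω) ∂P = ∫ ζ, f ζ ∂(productLaw unitRate φ) := by
  have hinit : ∀ h : Obs, ∫ ω, h (η 0 ω) ∂P = ∫ ζ, h ζ ∂(productLaw unitRate φ) := fun h => by
    rw [← hη.initial, integral_map (hη.measurable 0).aemeasurable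
      h.continuous.measurable.aestronglyMeasurable]
  have hbound : ∀ᶠ R : ℕ in atTop, |∫ ω, f (η t.toNNReal ω) ∂P
      - ∫ ζ, f ζ ∂(productLaw unitRate φ)| ≤ 2 * ‖f‖ * leak S M R * t := by
    filter_upwards [eventually_ge_atTop M] with R hR
    have := hη.abs_expectation_sub_le hS h0 h1.le hR hf le_rfl ht (G := fun _ => 1)
      measurable_const (K := 1) (fun _ => by simp)
    simp only [one_mul, sub_zero, Real.toNNReal_zero] at this
    rwa [hinit, integral_reservoirSemigroup h0 h1] at this
  have hlim : Tendsto (fun R : ℕ => 2 * ‖f‖ * leak S M R * t) atTop (𝓝 0) := by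
    simpa using ((tendsto_leak hTop hBot M).const_mul (2 * ‖f‖)).mul_const t
  exact sub_eq_zero.1 (abs_nonpos_iff.1 (ge_of_tendsto hlim hbound))

/-- The second moment of the time integral of a current. -/
lemma IsZeroRangeProcess.integral_sq_current_le (hS : StrictMono S) (hTop : Tendsto S atTop atTop)
    (hBot : Tendsto S atBot atBot) (h0 : 0 ≤ φ) (h1 : φ < 1)
    (hη : IsZeroRangeProcess (bondRate (conductance S)) unitRate (productLaw unitRate φ) 𝓕 P η)
    (A : Finset ℤ) (a : ℤ → ℝ) {T : ℝ} (hT : 0 ≤ T) :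
    ∫ ω, (∫ s in (0 : ℝ)..T, current A a (η s.toNNReal ω)) ^ 2 ∂P
      ≤ 2 * T * (φ * ∑ x ∈ A, a x ^ 2 * (S (x + 1) - S x)) := by
  have hm := hη.measurable
  have hrc := hη.right_continuous
  have := isProbabilityMeasure_productLaw h0 h1
  obtain ⟨M, hAM, hloc⟩ := exists_dependsOn_current A a
  set V := current A a with hV
  set c := conductance S with hc
  set N := φ * ∑ x ∈ A, a x ^ 2 * (S (x + 1) - S x) with hN
  have hN' : N = φ * ∑ x ∈ A, a x ^ 2 * (c x)⁻¹ := by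
    simp only [hN, hc, conductance, inv_inv]
  have hVb : ∀ (s : ℝ) ω, |V (η s.toNNReal ω)| ≤ ‖V‖ := fun s ω => V.norm_coe_le_norm _
  have hVm : ∀ s : ℝ, Measurable fun ω => V (η s.toNNReal ω) := fun s =>
    V.continuous.measurable.comp (hm _)
  -- the correlations of two times, up to an error
  have htwo : ∀ R, M ≤ R → ∀ r s : ℝ, 0 ≤ r → r ≤ s → s ≤ T →
      ∫ ω, V (η r.toNNReal ω) * V (η s.toNNReal ω) ∂P
      ≤ ∫ ζ, V ζ * reservoirSemigroup c φ R (s - r) V ζ ∂(productLaw unitRate φ)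
        + ‖V‖ * (2 * ‖V‖ * leak S M R) * T := by
    intro R hR r s hr hrs hsT
    have hlocR : DependsOn V (box R : Set ℤ) := fun η ζ h =>
      hloc fun i hi => h i (box_subset hR hi)
    have e1 := hη.abs_expectation_sub_le hS h0 h1.le hR hloc hr hrs
      (V.continuous.measurable.comp (hη.adapted r.toNNReal)) (fun ω => hVb r ω)
    have hdep : DependsOn (V * reservoirSemigroup c φ R (s - r) V : Obs) (box R : Set ℤ) := by
      intro η ζ h
      rw [BoundedContinuousFunction.coe_mul, Pi.mul_apply, Pi.mul_apply, hlocR h,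
        dependsOn_reservoirSemigroup hlocR (sub_nonneg.2 hrs) h]
    have e2 := hη.expectation_eq hS hTop hBot h0 h1 hdep hr
    simp only [BoundedContinuousFunction.coe_mul, Pi.mul_apply] at e2
    simp only [Function.comp_apply] at e1
    rw [e2] at e1
    have hnn : 0 ≤ ‖V‖ * (2 * ‖V‖ * leak S M R) := by
      have : 0 ≤ leak S M R := add_nonneg
        (inv_nonneg.2 (sub_nonneg.2 (hS.monotone (by omega))))
        (inv_nonneg.2 (sub_nonneg.2 (hS.monotone (by omega))))
      positivity
    have e3 : ‖V‖ * (2 * ‖V‖ * leak S M R) * (s - r) ≤ ‖V‖ * (2 * ‖V‖ * leak S M R) * T :=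
      mul_le_mul_of_nonneg_left (by linarith) hnn
    linarith [(abs_le.1 e1).2]
  have hcorr : ∀ R : ℕ, Continuous fun τ => ∫ ζ, V ζ * reservoirSemigroup c φ R τ V ζ
      ∂(productLaw unitRate φ) := by
    intro R
    obtain ⟨I, hI, -⟩ := exists_weighted_expectation (productLaw unitRate φ) measurable_id
      V.continuous.measurable (K := ‖V‖) (fun ζ => V.norm_coe_le_norm ζ)
    simp only [id] at hI
    simp_rw [← hI]
    exact I.continuous.comp (continuous_expFlow (reservoirGen c φ R) V)
  have hpast : ∀ R, M ≤ R → ∀ s, 0 ≤ s → s ≤ T →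
      ∫ τ in (0 : ℝ)..s, ∫ ζ, V ζ * reservoirSemigroup c φ R τ V ζ ∂(productLaw unitRate φ)
      ≤ N := by
    intro R hR s hs _
    rw [hN']
    exact integral_autocorrelation_current_le h0 h1 (fun x => conductance_pos hS x)
      (fun x hx => ⟨box_subset hR (hAM x hx).1, box_subset hR (hAM x hx).2⟩) a hs
  have hone : ∀ R, M ≤ R → ∀ s, 0 ≤ s → s ≤ T →
      ∫ r in (0 : ℝ)..T, ∫ ω, V (η s.toNNReal ω) * V (η r.toNNReal ω) ∂P
      ≤ 2 * N + ‖V‖ * (2 * ‖V‖ * leak S M R) * T * T := by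
    intro R hR s hs hsT
    set e := ‖V‖ * (2 * ‖V‖ * leak S M R) * T with he
    have hii : ∀ a b, IntervalIntegrable
        (fun r => ∫ ω, V (η s.toNNReal ω) * V (η r.toNNReal ω) ∂P) volume a b :=
      intervalIntegrable_expectation hm hrc P (hVm s) (hVb s) V
    rw [← intervalIntegral.integral_add_adjacent_intervals (hii 0 s) (hii s T)]
    have hleft : ∫ r in (0 : ℝ)..s, ∫ ω, V (η s.toNNReal ω) * V (η r.toNNReal ω) ∂P
        ≤ N + e * s := by
      calc _ ≤ ∫ r in (0 : ℝ)..s, (∫ ζ, V ζ * reservoirSemigroup c φ R (s - r) V ζ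
            ∂(productLaw unitRate φ) + e) := by
            refine intervalIntegral.integral_mono_on hs (hii 0 s)
              (Continuous.intervalIntegrable (by
                exact ((hcorr R).comp (continuous_const.sub continuous_id)).add
                  continuous_const) _ _) fun r hr => ?_
            simp_rw [mul_comm (V (η s.toNNReal _))]
            exact htwo R hR r s hr.1 hr.2 hsT
        _ = (∫ τ in (0 : ℝ)..s, ∫ ζ, V ζ * reservoirSemigroup c φ R τ V ζ
            ∂(productLaw unitRate φ)) + e * s := by
            rw [intervalIntegral.integral_add (Continuous.intervalIntegrable (by
                exact (hcorr R).comp (continuous_const.sub continuous_id)) _ _)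
              intervalIntegrable_const, intervalIntegral.integral_comp_sub_left
              (fun τ => ∫ ζ, V ζ * reservoirSemigroup c φ R τ V ζ ∂(productLaw unitRate φ)) s]
            simp [mul_comm]
        _ ≤ N + e * s := by linarith [hpast R hR s hs hsT]
    have hright : ∫ r in s..T, ∫ ω, V (η s.toNNReal ω) * V (η r.toNNReal ω) ∂P
        ≤ N + e * (T - s) := by
      calc _ ≤ ∫ r in s..T, (∫ ζ, V ζ * reservoirSemigroup c φ R (r - s) V ζ
            ∂(productLaw unitRate φ) + e) := by
            refine intervalIntegral.integral_mono_on hsT (hii s T)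
              (Continuous.intervalIntegrable (by
                exact ((hcorr R).comp (continuous_id.sub continuous_const)).add
                  continuous_const) _ _) fun r hr => ?_
            exact htwo R hR s r hs hr.1 hr.2
        _ = (∫ τ in (0 : ℝ)..(T - s), ∫ ζ, V ζ * reservoirSemigroup c φ R τ V ζ
            ∂(productLaw unitRate φ)) + e * (T - s) := by
            rw [intervalIntegral.integral_add (Continuous.intervalIntegrable (by
                exact (hcorr R).comp (continuous_id.sub continuous_const)) _ _)
              intervalIntegrable_const, intervalIntegral.integral_comp_sub_right
              (fun τ => ∫ ζ, V ζ * reservoirSemigroup c φ R τ V ζ ∂(productLaw unitRate φ)) s]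
            simp [mul_comm]
        _ ≤ N + e * (T - s) := by linarith [hpast R hR (T - s) (by linarith) (by linarith)]
    linarith
  -- Fubini, once for each of the two time integrals
  set Y : Ω → ℝ := fun ω => ∫ s in (0 : ℝ)..T, V (η s.toNNReal ω) with hY
  have hYm : Measurable Y := measurable_integral_path hm hrc V 0 T
  have hYb : ∀ ω, |Y ω| ≤ ‖V‖ * T := fun ω => by
    simpa using abs_integral_path_le (η := η) V ω hT
  have hsq : ∫ ω, Y ω ^ 2 ∂P
      = ∫ s in (0 : ℝ)..T, ∫ r in (0 : ℝ)..T, ∫ ω, V (η s.toNNReal ω) * V (η r.toNNReal ω) ∂P := by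
    simp_rw [pow_two]
    rw [integral_mul_integral_path hm hrc P hYm hYb V hT]
    refine intervalIntegral.integral_congr fun s _ => ?_
    rw [← integral_mul_integral_path hm hrc P (hVm s) (hVb s) V hT]
    exact integral_congr_ae (ae_of_all _ fun ω => mul_comm _ _)
  have hint : IntervalIntegrable (fun s => ∫ r in (0 : ℝ)..T,
      ∫ ω, V (η s.toNNReal ω) * V (η r.toNNReal ω) ∂P) volume 0 T := by
    refine (intervalIntegrable_expectation hm hrc P hYm hYb V 0 T).congr fun s _ => ?_
    rw [← integral_mul_integral_path hm hrc P (hVm s) (hVb s) V hT]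
    exact integral_congr_ae (ae_of_all _ fun ω => mul_comm _ _)
  have hfinal : ∀ᶠ R : ℕ in atTop, ∫ ω, Y ω ^ 2 ∂P
      ≤ (2 * N + ‖V‖ * (2 * ‖V‖ * leak S M R) * T * T) * T := by
    filter_upwards [eventually_ge_atTop M] with R hR
    rw [hsq]
    refine (intervalIntegral.integral_mono_on hT hint intervalIntegrable_const
      fun s hs => hone R hR s hs.1 hs.2).trans (le_of_eq ?_)
    rw [intervalIntegral.integral_const, smul_eq_mul, sub_zero, mul_comm]
  have hlim : Tendsto (fun R : ℕ => (2 * N + ‖V‖ * (2 * ‖V‖ * leak S M R) * T * T) * T) atTop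
      (𝓝 ((2 * N + ‖V‖ * (2 * ‖V‖ * 0) * T * T) * T)) :=
    ((((((tendsto_leak hTop hBot M).const_mul _).const_mul _).mul_const _).mul_const _).const_add
      _).mul_const _
  refine (ge_of_tendsto hlim hfinal).trans (le_of_eq (by ring))

end Dynamics

/-! ### The infinite current as a limit in `L²` -/

lemma current_eq_sum (A : Finset ℤ) (a : ℤ → ℝ) : current A a = ∑ x ∈ A, current {x} a := by
  simp [current]

lemma norm_current_singleton_le (x : ℤ) (a : ℤ → ℝ) : ‖current {x} a‖ ≤ |a x| := by
  refine (BoundedContinuousFunction.norm_le (abs_nonneg _)).2 fun η => ?_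
  rw [current_apply, Finset.sum_singleton, norm_mul, Real.norm_eq_abs]
  refine mul_le_of_le_one_right (abs_nonneg _) (abs_le.2 ⟨?_, ?_⟩) <;>
    linarith [unitRate_nonneg (η x), unitRate_nonneg (η (x + 1)), unitRate_le_one (η x),
      unitRate_le_one (η (x + 1))]

lemma eLpNorm_two_toReal_sq {Ω : Type*} {mΩ : MeasurableSpace Ω} {P : Measure Ω} {f : Ω → ℝ}
    (hf : MemLp f 2 P) : (eLpNorm f 2 P).toReal ^ 2 = ∫ ω, f ω ^ 2 ∂P := by
  have hnn : 0 ≤ ∫ ω, f ω ^ 2 ∂P := integral_nonneg fun ω => sq_nonneg _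
  rw [hf.eLpNorm_eq_integral_rpow_norm (by simp) (by simp)]
  simp only [ENNReal.toReal_ofNat, Real.rpow_ofNat, Real.norm_eq_abs, sq_abs]
  rw [ENNReal.toReal_ofReal (by positivity), ← Real.rpow_natCast, ← Real.rpow_mul hnn]
  norm_num

section Limit

variable {Ω : Type*} {mΩ : MeasurableSpace Ω} {P : Measure Ω} [IsProbabilityMeasure P]
  {𝓕 : Filtration ℝ≥0 mΩ} {η : ℝ≥0 → Ω → Config} {S : ℤ → ℝ} {φ : ℝ}

/-- The time integral of an infinite current exists in `L²` as soon as the second moment bounds of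
its finite parts are summable, and it inherits their bound. -/
lemma IsZeroRangeProcess.exists_integral_current (hS : StrictMono S)
    (hTop : Tendsto S atTop atTop) (hBot : Tendsto S atBot atBot) (h0 : 0 ≤ φ) (h1 : φ < 1)
    (hη : IsZeroRangeProcess (bondRate (conductance S)) unitRate (productLaw unitRate φ) 𝓕 P η)
    {a : ℤ → ℝ} (ha : Summable fun x => a x ^ 2 * (S (x + 1) - S x)) {T : ℝ} (hT : 0 ≤ T) :
    ∃ I : Ω → ℝ, MemLp I 2 P ∧
      Tendsto (fun A : Finset ℤ => eLpNorm (fun ω =>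
        (∫ s in (0 : ℝ)..T, current A a (η s.toNNReal ω)) - I ω) 2 P) atTop (𝓝 0) ∧
      (Summable a → ∀ᵐ ω ∂P, I ω = ∫ s in (0 : ℝ)..T,
        ∑' x : ℤ, a x * (unitRate (η s.toNNReal ω x) - unitRate (η s.toNNReal ω (x + 1)))) ∧
      ∫ ω, I ω ^ 2 ∂P ≤ 2 * T * (φ * ∑' x, a x ^ 2 * (S (x + 1) - S x)) := by
  have hm := hη.measurable
  have hrc := hη.right_continuous
  set J : Obs → Ω → ℝ := fun f ω => ∫ s in (0 : ℝ)..T, f (η s.toNNReal ω) with hJ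
  have hJm : ∀ f, Measurable (J f) := fun f => measurable_integral_path hm hrc f 0 T
  have hJb : ∀ f ω, |J f ω| ≤ ‖f‖ * T := fun f ω => by
    simpa using abs_integral_path_le (η := η) f ω hT
  have hJL : ∀ f, MemLp (J f) 2 P := fun f =>
    MemLp.of_bound (hJm f).aestronglyMeasurable (‖f‖ * T) (ae_of_all _ (hJb f))
  have hJadd : ∀ f g, J (f + g) = J f + J g := fun f g => by
    funext ω
    exact intervalIntegral.integral_add (intervalIntegrable_obs_path hm hrc f ω 0 T)
      (intervalIntegrable_obs_path hm hrc g ω 0 T)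
  have hJsub : ∀ f g, J (f - g) = J f - J g := fun f g => by
    funext ω
    exact intervalIntegral.integral_sub (intervalIntegrable_obs_path hm hrc f ω 0 T)
      (intervalIntegrable_obs_path hm hrc g ω 0 T)
  set j : ℤ → Lp ℝ 2 P := fun x => (hJL (current {x} a)).toLp with hj
  have hjsum : ∀ A : Finset ℤ, ∑ x ∈ A, j x = (hJL (current A a)).toLp := by
    intro A
    induction A using Finset.induction_on with
    | empty =>
      have : J (current ∅ a) = 0 := by funext ω; simp [hJ, current]
      rw [Finset.sum_empty, eq_comm]
      simp only [this]
      exact MemLp.toLp_zero _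
    | insert x A hx ih =>
      have : J (current (insert x A) a) = J (current {x} a) + J (current A a) := by
        rw [← hJadd, current_eq_sum (insert x A), Finset.sum_insert hx, ← current_eq_sum]
      rw [Finset.sum_insert hx, ih, hj, ← MemLp.toLp_add]
      simp only [this]
  have hnorm : ∀ A : Finset ℤ, ‖∑ x ∈ A, j x‖ ^ 2
      ≤ 2 * T * (φ * ∑ x ∈ A, a x ^ 2 * (S (x + 1) - S x)) := by
    intro A
    rw [hjsum, Lp.norm_toLp, eLpNorm_two_toReal_sq (hJL _)]
    exact hη.integral_sq_current_le hS hTop hBot h0 h1 A a hT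
  have hsum : Summable j := by
    rw [summable_iff_vanishing_norm]
    intro ε hε
    have hc : Summable fun x => 2 * T * φ * (a x ^ 2 * (S (x + 1) - S x)) := ha.mul_left _
    obtain ⟨s, hs⟩ := summable_iff_vanishing_norm.1 hc (ε ^ 2) (by positivity)
    refine ⟨s, fun A hA => ?_⟩
    have h2 := (le_abs_self _).trans_lt (hs A hA)
    rw [← Finset.mul_sum, mul_assoc (2 * T)] at h2
    exact lt_of_pow_lt_pow_left₀ 2 hε.le ((hnorm A).trans_lt h2)
  set I : Lp ℝ 2 P := ∑' x, j x with hI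
  have hlim : Tendsto (fun A : Finset ℤ => ∑ x ∈ A, j x) atTop (𝓝 I) := hsum.hasSum
  have hIL : MemLp I 2 P := Lp.memLp I
  have hconv : Tendsto (fun A : Finset ℤ => eLpNorm (fun ω =>
      J (current A a) ω - I ω) 2 P) atTop (𝓝 0) := by
    have e : I = hIL.toLp := (Lp.toLp_coeFn I hIL).symm
    simp_rw [hjsum] at hlim
    rw [e] at hlim
    exact (Lp.tendsto_Lp_iff_tendsto_eLpNorm'' _ (fun A => hJL (current A a)) _ hIL).1 hlim
  refine ⟨I, hIL, hconv, fun hsa => ?_, ?_⟩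
  · have hV : Summable fun x => current {x} a :=
      Summable.of_norm_bounded hsa.abs fun x => norm_current_singleton_le x a
    set V : Obs := ∑' x, current {x} a with hVdef
    have hVapply : ∀ ζ, V ζ = ∑' x : ℤ, a x * (unitRate (ζ x) - unitRate (ζ (x + 1))) := by
      intro ζ
      have h2 := (hV.hasSum.mapL (evalAt ζ)).tsum_eq
      rw [evalAt_apply] at h2
      rw [← h2]
      exact tsum_congr fun x => by rw [evalAt_apply, current_apply, Finset.sum_singleton]
    simp_rw [← hVapply]
    have hunif : Tendsto (fun A : Finset ℤ => eLpNorm (J (current A a) - J V) 2 P) atTop (𝓝 0) := by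
      have h3 : Tendsto (fun A : Finset ℤ => ‖current A a - V‖ * T) atTop (𝓝 0) := by
        have h4 : Tendsto (fun A : Finset ℤ => ∑ x ∈ A, current {x} a) atTop (𝓝 V) := hV.hasSum
        simp_rw [← current_eq_sum] at h4
        simpa using (tendsto_iff_norm_sub_tendsto_zero.1 h4).mul_const T
      have h5 := ENNReal.tendsto_ofReal h3
      rw [ENNReal.ofReal_zero] at h5
      refine tendsto_of_tendsto_of_tendsto_of_le_of_le tendsto_const_nhds h5
        (fun _ => zero_le) fun A => ?_
      rw [← hJsub]
      refine (eLpNorm_le_of_ae_bound (ae_of_all _ (hJb (current A a - V)))).trans (le_of_eq ?_)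
      simp
    have hzero : eLpNorm (J V - (I : Ω → ℝ)) 2 P = 0 := by
      have h6 := hunif.add hconv
      rw [add_zero] at h6
      refine le_antisymm (ge_of_tendsto' h6 fun A => ?_) zero_le
      have h7 : J V - (I : Ω → ℝ)
          = (fun ω => J (current A a) ω - I ω) - (J (current A a) - J V) := by
        funext ω; simp
      rw [h7, add_comm]
      exact eLpNorm_sub_le ((hJL _).sub hIL).1 ((hJL _).sub (hJL _)).1 one_le_two
    rw [eLpNorm_eq_zero_iff ((hJL V).sub hIL).1 two_ne_zero] at hzero
    filter_upwards [hzero] with ω hω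
    exact (sub_eq_zero.1 hω).symm
  · rw [← eLpNorm_two_toReal_sq hIL, ← Lp.norm_def]
    refine le_of_tendsto ((continuous_norm.pow 2).continuousAt.tendsto.comp hlim)
      (Eventually.of_forall fun A => (hnorm A).trans ?_)
    have hle := ha.sum_le_tsum A fun x _ =>
      mul_nonneg (sq_nonneg (a x)) (sub_nonneg.2 (hS.monotone (by omega : x ≤ x + 1)))
    gcongr

end Limit

/-! ### The subdiffusive scaling -/

/-- The scale function whose increments are the environment. -/
noncomputable def scale (α : ℝ) (W : ℝ → ℝ) (n : ℕ) (x : ℤ) : ℝ :=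
  (n : ℝ) ^ (1 / α) * W ((x : ℝ) / n)

lemma scale_add_one_sub (α : ℝ) (W : ℝ → ℝ) (n : ℕ) (x : ℤ) :
    scale α W n (x + 1) - scale α W n x = (n : ℝ) ^ (1 / α) * increment W n x := by
  simp only [scale, increment]
  push_cast
  ring

lemma jumpRate_eq_bondRate (α : ℝ) (W : ℝ → ℝ) (n : ℕ) :
    jumpRate α W n = bondRate (conductance (scale α W n)) := by
  funext x y
  simp only [jumpRate, bondRate, conductance, environment, scale_add_one_sub]

lemma strictMono_scale (α : ℝ) {W : ℝ → ℝ} (hW : StrictMono W) {n : ℕ} (hn : 0 < n) :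
    StrictMono (scale α W n) := by
  intro x y hxy
  have hn' : (0 : ℝ) < n := Nat.cast_pos.2 hn
  have hxy' : (x : ℝ) < y := Int.cast_lt.2 hxy
  exact mul_lt_mul_of_pos_left (hW (div_lt_div_of_pos_right hxy' hn')) (Real.rpow_pos_of_pos hn' _)

lemma tendsto_scale_atTop (α : ℝ) {W : ℝ → ℝ} (hW : Tendsto W atTop atTop) {n : ℕ} (hn : 0 < n) :
    Tendsto (scale α W n) atTop atTop := by
  have hn' : (0 : ℝ) < n := Nat.cast_pos.2 hn
  exact (hW.comp (tendsto_intCast_atTop_atTop.atTop_div_const hn')).const_mul_atTop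
    (Real.rpow_pos_of_pos hn' _)

lemma tendsto_scale_atBot (α : ℝ) {W : ℝ → ℝ} (hW : Tendsto W atBot atBot) {n : ℕ} (hn : 0 < n) :
    Tendsto (scale α W n) atBot atBot := by
  have hn' : (0 : ℝ) < n := Nat.cast_pos.2 hn
  exact (hW.comp ((tendsto_intCast_atBot_iff.2 tendsto_id).atBot_div_const hn')).const_mul_atBot
    (Real.rpow_pos_of_pos hn' _)

end ZeroRange

theorem theorem6 {Ω : Type*} {mΩ : MeasurableSpace Ω} (P : Measure Ω) [IsProbabilityMeasure P]
    (𝓕 : Filtration ℝ≥0 mΩ)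
    (α : ℝ) (hα0 : 0 < α) (hα1 : α < 1)
    (W : ℝ → ℝ) (hW : StrictMono W) (hWtop : Tendsto W atTop atTop) (hWbot : Tendsto W atBot atBot)
    (n : ℕ) (hn : 0 < n) (ρ : ℝ) (hρ : 0 < ρ)
    (η : ℝ≥0 → Ω → ZeroRange.Config)
    (hη : ZeroRange.IsZeroRangeProcess (ZeroRange.jumpRate α W n) ZeroRange.unitRate
      (ZeroRange.equilibrium ZeroRange.unitRate ρ) 𝓕 P η)
    (t : ℝ) (ht : 0 ≤ t) (H : ℝ → ℝ)
    (hH : Summable fun x : ℤ => H ((x : ℝ) / n) ^ 2 * ZeroRange.increment W n x) :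
    ∃ I : Ω → ℝ, MemLp I 2 P ∧
      -- `I` is the time integral of the series: the limit in `L²(P)` over finite sets of sites
      Tendsto (fun A : Finset ℤ => eLpNorm (fun ω =>
          (∫ s in (0 : ℝ)..t, 1 / √(n : ℝ) * ∑ x ∈ A,
            ZeroRange.currentTerm ZeroRange.unitRate n H x (ZeroRange.rescaled α n η s ω)) - I ω)
          2 P) atTop (𝓝 0) ∧
      -- it is the pathwise integral as soon as the series converges absolutely
      ((Summable fun x : ℤ => H ((x : ℝ) / n)) →
        ∀ᵐ ω ∂P, I ω = ∫ s in (0 : ℝ)..t, 1 / √(n : ℝ) * ∑' x : ℤ,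
          ZeroRange.currentTerm ZeroRange.unitRate n H x (ZeroRange.rescaled α n η s ω)) ∧
      ∫ ω, I ω ^ 2 ∂P ≤ 5 * t * (ZeroRange.fugacity ZeroRange.unitRate ρ)⁻¹ *
        ∑' x : ℤ, H ((x : ℝ) / n) ^ 2 * ZeroRange.increment W n x := by
  have hn' : (0 : ℝ) < n := Nat.cast_pos.2 hn
  obtain ⟨h0, h1⟩ := ZeroRange.fugacity_mem hρ
  set φ := ZeroRange.fugacity ZeroRange.unitRate ρ with hφ
  set N : ℝ := (n : ℝ) ^ (1 + 1 / α) with hN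
  have hNpos : 0 < N := Real.rpow_pos_of_pos hn' _
  have hNmul : N = n * (n : ℝ) ^ (1 / α) := by rw [hN, Real.rpow_add hn', Real.rpow_one]
  set κ : ℝ := N⁻¹ * (1 / √(n : ℝ) * n) with hκ
  have hκ2 : κ ^ 2 * (n : ℝ) ^ (1 / α) * N = 1 := by
    have hs : √(n : ℝ) ^ 2 = n := Real.sq_sqrt hn'.le
    have hs0 : √(n : ℝ) ≠ 0 := (Real.sqrt_pos.2 hn').ne'
    have hp : (n : ℝ) ^ (1 / α) ≠ 0 := (Real.rpow_pos_of_pos hn' _).ne'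
    rw [hκ, hNmul, mul_pow, mul_pow, div_pow, hs]
    field_simp
  set a : ℤ → ℝ := fun x => κ * H ((x : ℝ) / n) with ha
  have hterm : ∀ x, a x ^ 2 * (ZeroRange.scale α W n (x + 1) - ZeroRange.scale α W n x)
      = κ ^ 2 * (n : ℝ) ^ (1 / α) * (H ((x : ℝ) / n) ^ 2 * ZeroRange.increment W n x) :=
    fun x => by rw [ZeroRange.scale_add_one_sub, ha]; ring
  rw [ZeroRange.jumpRate_eq_bondRate] at hη
  obtain ⟨I, hI, hlim, hpath, hsq⟩ := hη.exists_integral_current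
    (ZeroRange.strictMono_scale α hW hn) (ZeroRange.tendsto_scale_atTop α hWtop hn)
    (ZeroRange.tendsto_scale_atBot α hWbot hn) h0 h1 (a := a)
    (by simp_rw [hterm]; exact hH.mul_left _) (mul_nonneg ht hNpos.le)
  -- the time change `s ↦ s N`
  have htime : ∀ (F : ZeroRange.Config → ℝ) ω,
      ∫ s in (0 : ℝ)..t, 1 / √(n : ℝ) * (n * F (ZeroRange.rescaled α n η s ω))
        = ∫ s in (0 : ℝ)..t * N, κ * F (η s.toNNReal ω) := by
    intro F ω
    have := intervalIntegral.integral_comp_mul_right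
      (fun s => F (η s.toNNReal ω)) hNpos.ne' (a := 0) (b := t)
    simp only [← mul_assoc, intervalIntegral.integral_const_mul]
    simp only [ZeroRange.rescaled]
    rw [this, zero_mul, smul_eq_mul, hκ]
    ring
  refine ⟨I, hI, ?_, fun hHs => ?_, hsq.trans ?_⟩
  · refine hlim.congr fun A => ?_
    congr 1
    funext ω
    congr 1
    have e := htime (fun ζ => ∑ x ∈ A, H ((x : ℝ) / n) *
      (ZeroRange.unitRate (ζ x) - ZeroRange.unitRate (ζ (x + 1)))) ω
    simp only [Finset.mul_sum] at e ⊢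
    simp only [ZeroRange.currentTerm, ZeroRange.current_apply, ha]
    refine (Eq.trans ?_ e.symm).trans ?_ <;>
    · refine intervalIntegral.integral_congr fun s _ => Finset.sum_congr rfl fun x _ => ?_
      ring
  · filter_upwards [hpath (hHs.mul_left κ)] with ω hω
    have e := htime (fun ζ => ∑' x : ℤ, H ((x : ℝ) / n) *
      (ZeroRange.unitRate (ζ x) - ZeroRange.unitRate (ζ (x + 1)))) ω
    rw [hω]
    simp only [← tsum_mul_left] at e ⊢
    simp only [ZeroRange.currentTerm, ha]
    refine (Eq.trans ?_ e.symm).trans ?_ <;>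
    · refine intervalIntegral.integral_congr fun s _ => tsum_congr fun x => ?_
      ring
  · simp_rw [hterm]
    rw [tsum_mul_left]
    set D := ∑' x : ℤ, H ((x : ℝ) / n) ^ 2 * ZeroRange.increment W n x with hD
    have hDnn : 0 ≤ D := tsum_nonneg fun x => mul_nonneg (sq_nonneg _) (sub_nonneg.2
      (hW.monotone (div_le_div_of_nonneg_right (by linarith) hn'.le)))
    have e : 2 * (t * N) * (φ * (κ ^ 2 * (n : ℝ) ^ (1 / α) * D)) = 2 * t * φ * D := by
      linear_combination 2 * t * φ * D * hκ2
    rw [e]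
    -- `2 φ ≤ 5 / φ` because `φ < 1`; for `φ = 0` both sides vanish
    have hφφ : 2 * φ ≤ 5 * φ⁻¹ := by
      rcases h0.eq_or_lt with h | h
      · simp [← h]
      · have : 1 ≤ φ⁻¹ := (one_le_inv₀ h).2 h1.le
        linarith
    have := mul_le_mul_of_nonneg_right hφφ (mul_nonneg ht hDnn)
    linarith
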